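/- All graphs are finite and simple. For a graph $G$ write $|G|$ and $e(G)$ for its numbers of vertices and edges, $N(x)$ for the neighborhood of a vertex $x$, $d_G(u,v)$ for the distance between $u$ and $v$, and $d_G(v,X)=\min_{x\in X} d_G(v,x)$ for a nonempty set $X$ of vertices. A vertex $a$ is complete to a set $B$ of vertices if $a$ is adjacent to every vertex of $B$. An antimagic orientation of a graph $G$ with $m$ edges is a pair $(D,\tau)$, where $D$ is an orientation of $G$ and $\tau$ is a bijection from the set of arcs of $D$ onto $\{1,\dots,m\}$, such that the vertex-sums of any two distinct vertices are different; the vertex-sum of $u$ is the sum of the labels of all arcs entering $u$ minus the sum of the labels of all arcs leaving $u$. **Theorem 1.6.** Let $G$ be a connected graph and let $X=\{x_1,\dots,x_t\}\subseteq V(G)$ be a set of $t\in\{1,2,3\}$ distinct vertices such that $d_G(v,X)\le 2$ for each $v\in V(G)\setminus X$. Suppose that one of the following holds: (i) $t=1$ and $|N(x_1)|\ge 2$; or (ii) $t=2$, $e(G)\ge 2|G|-5$, and there exist distinct vertices $y_1,\dots,y_7\in V(G)\setminus X$ such that $x_1$ is complete to either $\{y_1,y_2,y_3,x_2\}$ or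 $\{y_1,y_2,y_3,y_4\}$, and $x_2$ is complete to $\{y_4,y_5,y_6,y_7\}$; or (iii) $t=3$, $e(G)\ge 2|G|-4$, and there exist distinct vertices $y_1,\dots,y_{11}\in V(G)\setminus X$ such that $x_1$ is complete to $\{y_1,y_2,y_3,y_4\}$, $x_2$ is complete to $\{y_4,y_5,y_6,y_7,y_8\}$, and $x_3$ is complete to either $\{y_4,y_9,y_{10},y_{11}\}$ or $\{y_8,y_9,y_{10},y_{11}\}$. Then $G$ admits an antimagic orientation. -/

import Mathlib

/-- `D` is an orientation of the simple graph `G`: every edge of `G` is replaced by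
exactly one of its two possible arcs, and there are no other arcs. -/
structure IsOrientation {V : Type*} (D : Digraph V) (G : SimpleGraph V) : Prop where
  adj_iff : ∀ u v : V, G.Adj u v ↔ D.Adj u v ∨ D.Adj v u
  asymm : ∀ u v : V, D.Adj u v → ¬ D.Adj v u

/-- The arc set `A(D)`; the pair `(u, v)` is the arc from `u` to `v`. -/
def arcSet {V : Type*} (D : Digraph V) : Set (V × V) :=
  {e | D.Adj e.1 e.2}

open Classical in
/-- The vertex-sum `s_{(D,τ)}(u)`: the sum of the labels of the arcs entering `u` minus the sum of
the labels of the arcs leaving `u`. It is `0` at an isolated vertex. -/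
noncomputable def vertexSum {V : Type*} [Fintype V] (D : Digraph V) (τ : V × V → ℕ) (u : V) : ℤ :=
  (∑ w : V with D.Adj w u, (τ (w, u) : ℤ)) - ∑ w : V with D.Adj u w, (τ (u, w) : ℤ)

/-- `τ` (only its values on arcs matter) is an antimagic labeling of the digraph `D` with `m` arcs:
it is a bijection from `A(D)` onto `{1, …, m}`, and distinct vertices have distinct vertex-sums. -/
structure IsAntimagicLabeling {V : Type*} [Fintype V] (D : Digraph V) (τ : V × V → ℕ) : Prop where
  bijOn : Set.BijOn τ (arcSet D) (Set.Icc 1 (arcSet D).ncard)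
  sum_ne : ∀ u v : V, u ≠ v → vertexSum D τ u ≠ vertexSum D τ v

/-- `G` admits an antimagic orientation. -/
def AdmitsAntimagicOrientation {V : Type*} [Fintype V] (G : SimpleGraph V) : Prop :=
  ∃ (D : Digraph V) (τ : V × V → ℕ), IsOrientation D G ∧ IsAntimagicLabeling D τ

/-- The vertex `a` is complete to the set `B` in `G`: it is adjacent to all vertices in `B`. -/
def IsCompleteTo {V : Type*} (G : SimpleGraph V) (a : V) (B : Set V) : Prop :=
  ∀ b ∈ B, G.Adj a b

/-!
Choose a forest in which every vertex reaches `X` in at most two steps. The edges outside the forest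
get the smallest labels, with signs alternating along a pairing of the edges at each vertex, so that
no vertex-sum exceeds the largest of these labels in absolute value. The forest edges far from `X`
come next and point towards `X`; the forest edges at `X` get the largest labels and point away from
`X`. Sorting the labels within both layers makes the sums outside `X` distinct, and a vertex of `X`
with three leaves of its own has a smaller sum than all of them. Only sums of vertices of `X` can
still coincide, and they are separated by relabelling a few edges: by permuting the labels at a
common neighbour, by reversing an edge inside `X`, or, if `x₁` and `x₂` share the neighbour `a`
and `x₂` and `x₃` share `b`, by interchanging the labels of the two edges from `X` to `a` or to `b`.
-/

section Involutions

variable {D : Type*}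

/- Reflections: every power of the rotation `α * β` becomes its inverse under conjugation by `α`, so
a power carrying `d` to `α d` would give a fixed point of `α` (even power) or `β` (odd power). -/
theorem not_sameCycle_mul_of_involutive {α β : Equiv.Perm D} (hα : Function.Involutive α)
    (hβ : Function.Involutive β) (hα' : ∀ d, α d ≠ d) (hβ' : ∀ d, β d ≠ d) (d : D) :
    ¬ (α * β).SameCycle d (α d) := by
  rintro ⟨k, hk⟩
  have α_mul_zpow (n : ℤ) (d : D) : α (((α * β) ^ n) d) = ((α * β) ^ (-n)) (α d) := by
    have hβ₁ : β⁻¹ = β := inv_eq_of_mul_eq_one_right (Equiv.ext hβ)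
    have hconj : α * (α * β) * α⁻¹ = (α * β)⁻¹ := by
      rw [mul_inv_rev, hβ₁, ← mul_assoc, mul_inv_eq_iff_eq_mul, inv_mul_cancel_right,
        Equiv.ext (g := 1) (f := α * α) hα, one_mul]
    have hzpow : α * (α * β) ^ n * α⁻¹ = (α * β) ^ (-n) := by
      rw [← conj_zpow, hconj, inv_zpow, zpow_neg]
    exact congrArg (· d) (mul_inv_eq_iff_eq_mul.1 hzpow)
  rcases Int.even_or_odd' k with ⟨j, rfl | rfl⟩
  · apply hα' (((α * β) ^ j) d)
    rw [α_mul_zpow, ← hk, ← Equiv.Perm.mul_apply, ← zpow_add]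
    congr 2
    ring
  · apply hβ' (((α * β) ^ j) d)
    have hβ_eq (e : D) : β e = α ((α * β) e) := (hα (β e)).symm
    rw [hβ_eq, ← Equiv.Perm.mul_apply (α * β), ← zpow_one_add, α_mul_zpow, ← hk,
      ← Equiv.Perm.mul_apply, ← zpow_add]
    congr 2
    ring

theorem exists_sign_of_involutive_of_ne {α β : Equiv.Perm D} (hα : Function.Involutive α)
    (hβ : Function.Involutive β) (hα' : ∀ d, α d ≠ d) (hβ' : ∀ d, β d ≠ d) :
    ∃ ε : D → ℤˣ, ∀ d, ε (α d) = -ε d ∧ ε (β d) = -ε d := by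
  classical
  let s := Equiv.Perm.SameCycle.setoid (α * β)
  let q : D → Quotient s := Quotient.mk s
  let _ : LinearOrder (Quotient s) := linearOrderOfSTO WellOrderingRel
  have q_ne (d : D) : q d ≠ q (α d) := fun h ↦
    not_sameCycle_mul_of_involutive hα hβ hα' hβ' d (Quotient.exact h)
  have q_αβ (d : D) : q (α (β d)) = q d :=
    Quotient.sound (Equiv.Perm.sameCycle_apply_left.2 (Equiv.Perm.SameCycle.refl (α * β) d))
  have q_β (d : D) : q (β d) = q (α d) := by rw [← q_αβ (β d), hβ d]
  have sign_swap {x y : Quotient s} (h : x ≠ y) :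
      (if y < x then (1 : ℤˣ) else -1) = -(if x < y then 1 else -1) := by
    rcases h.lt_or_gt with h | h <;> simp [h, h.not_gt]
  refine ⟨fun d ↦ if q d < q (α d) then 1 else -1, fun d ↦ ⟨?_, ?_⟩⟩
  · simpa only [hα d] using sign_swap (q_ne d)
  · simpa only [q_β, q_αβ] using sign_swap (q_ne d)

theorem exists_sign_of_involutive {α β : Equiv.Perm D} (hα : Function.Involutive α)
    (hβ : Function.Involutive β) (hα' : ∀ d, α d ≠ d) :
    ∃ ε : D → ℤˣ, ∀ d, ε (α d) = -ε d ∧ (β d ≠ d → ε (β d) = -ε d) := by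
  classical
  -- On two copies of `D`, a fixed point of `β` can be matched with its twin.
  let A : D × Bool → D × Bool := fun d ↦ (α d.1, d.2)
  let B : D × Bool → D × Bool := fun d ↦ if β d.1 = d.1 then (d.1, !d.2) else (β d.1, d.2)
  have hA : Function.Involutive A := fun d ↦ Prod.ext (hα d.1) rfl
  have hB : Function.Involutive B := fun d ↦ by
    by_cases hd : β d.1 = d.1
    · simp [B, hd]
    · simp [B, hd, hβ d.1, Ne.symm hd]
  have hB' (d) : B d ≠ d := by
    by_cases hd : β d.1 = d.1 <;> simp [B, hd, Prod.ext_iff]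
  obtain ⟨ε, hε⟩ := exists_sign_of_involutive_of_ne (α := hA.toPerm) (β := hB.toPerm) hA hB
    (fun d h ↦ hα' d.1 (congrArg Prod.fst h)) hB'
  refine ⟨fun d ↦ ε (d, false), fun d ↦ ⟨(hε (d, false)).1, fun hd ↦ ?_⟩⟩
  simpa [Function.Involutive.toPerm, B, hd] using (hε (d, false)).2

end Involutions

section Balancing

variable {V : Type*}

theorem abs_units_mul_of_nonneg (s : ℤˣ) {x : ℤ} (hx : 0 ≤ x) : |s * x| = x := by
  rcases Int.units_eq_one_or s with rfl | rfl <;> simpa using hx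

theorem exists_pairing (ω : V → ℤ) (A : Finset V) {W : ℤ} (hW : 0 ≤ W)
    (hω : ∀ a ∈ A, ω a ∈ Set.Icc 0 W) :
    ∃ β : Equiv.Perm V, Function.Involutive β ∧ (∀ a ∉ A, β a = a) ∧
      ∀ ε : V → ℤˣ, (∀ a, β a ≠ a → ε (β a) = -ε a) → |∑ a ∈ A, ε a * ω a| ≤ W := by
  classical
  induction A using Finset.strongInduction generalizing W with
  | H A ih =>
  rcases A.eq_empty_or_nonempty with rfl | hA
  · exact ⟨1, fun _ ↦ rfl, fun _ _ ↦ rfl, fun _ _ ↦ by simpa using hW⟩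
  obtain ⟨a, ha, ha_max⟩ := A.exists_max_image ω hA
  rcases (A.erase a).eq_empty_or_nonempty with hA' | hA'
  · refine ⟨1, fun _ ↦ rfl, fun _ _ ↦ rfl, fun ε _ ↦ ?_⟩
    rw [← Finset.add_sum_erase A _ ha, hA', Finset.sum_empty, add_zero,
      abs_units_mul_of_nonneg _ (hω a ha).1]
    exact (hω a ha).2
  obtain ⟨b, hb, hb_max⟩ := (A.erase a).exists_max_image ω hA'
  have hbA := Finset.mem_of_mem_erase hb
  have hab : a ≠ b := (Finset.ne_of_mem_erase hb).symm
  obtain ⟨β, hβ, hβ_fix, hβ_sum⟩ := ih ((A.erase a).erase b)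
    ((Finset.erase_ssubset hb).trans (Finset.erase_ssubset ha)) (hω b hbA).1
    (fun v hv ↦ ⟨(hω v (by grind)).1, hb_max v (Finset.mem_of_mem_erase hv)⟩)
  have hβa : β a = a := hβ_fix a (by simp)
  have hβb : β b = b := hβ_fix b (by simp)
  have hβ_swap (v) : (Equiv.swap a b * β) v = if v = a then b else if v = b then a else β v := by
    rw [Equiv.Perm.mul_apply, Equiv.swap_apply_def]
    grind [hβ.injective.eq_iff]
  refine ⟨Equiv.swap a b * β, ?_, ?_, fun ε hε ↦ ?_⟩
  · intro v
    grind [hβ v]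
  · grind
  have hεb : ε b = -ε a := by simpa [hβa, hab.symm] using hε a
  have hsum := hβ_sum ε (fun v hv ↦ by
    have := hε v
    grind)
  calc |∑ v ∈ A, ε v * ω v|
      = |ε a * (ω a - ω b) + ∑ v ∈ (A.erase a).erase b, ε v * ω v| := by
        rw [← Finset.add_sum_erase A _ ha, ← Finset.add_sum_erase (A.erase a) _ hb, hεb]
        push_cast
        ring_nf
    _ ≤ |ε a * (ω a - ω b)| + ω b := (abs_add_le _ _).trans (add_le_add le_rfl hsum)
    _ = ω a := by rw [abs_units_mul_of_nonneg _ (sub_nonneg.2 (ha_max b hbA)), sub_add_cancel]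
    _ ≤ W := (hω a ha).2

/-- The net flow into `u`, where `f (v, w)` is the flow along the dart `(v, w)`. -/
def inflow [Fintype V] (f : V × V → ℤ) (u : V) : ℤ := ∑ w, f (w, u)

/- At every vertex `u` the neighbours of `u` are paired by decreasing weight; signs that alternate
along these pairs and along edges exist because both are involutions of the darts. -/
theorem exists_balanced_flow [Fintype V] (L : Sym2 V → ℤ) {W : ℤ} (hW : 0 ≤ W)
    (hL : ∀ e, L e ∈ Set.Icc 0 W) (hdiag : ∀ v, L s(v, v) = 0) :
    ∃ f : V × V → ℤ, (∀ d, f d.swap = -f d) ∧ (∀ d, |f d| = L s(d.1, d.2)) ∧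
      ∀ u, |inflow f u| ≤ W := by
  classical
  choose β hβ hβ_fix hβ_sum using fun u : V ↦
    exists_pairing (fun w ↦ L s(w, u)) (Finset.univ.erase u) hW (fun w _ ↦ hL _)
  let D := {d : V × V // d.1 ≠ d.2}
  let a : D → D := fun d ↦ ⟨d.1.swap, d.2.symm⟩
  let b : D → D := fun d ↦ ⟨(β d.1.2 d.1.1, d.1.2), fun h ↦ d.2 <| by
    have hfix := hβ_fix d.1.2 d.1.2 (by simp)
    exact (β d.1.2).injective (h.trans hfix.symm)⟩
  have ha : Function.Involutive a := fun _ ↦ rfl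
  have hb : Function.Involutive b := fun d ↦ Subtype.ext (Prod.ext (hβ _ _) rfl)
  obtain ⟨ε, hε⟩ := exists_sign_of_involutive (α := ha.toPerm) (β := hb.toPerm) ha hb
    (fun d h ↦ d.2 (congrArg Prod.snd (congrArg Subtype.val h)))
  let sgn : V × V → ℤˣ := fun d ↦ if h : d.1 ≠ d.2 then ε ⟨d, h⟩ else 1
  refine ⟨fun d ↦ sgn d * L s(d.1, d.2), fun ⟨u, v⟩ ↦ ?_, fun d ↦ ?_, fun u ↦ ?_⟩
  · by_cases h : u = v
    · simp [h, hdiag]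
    · have hsgn : sgn (v, u) = -sgn (u, v) := by
        simpa [sgn, a, h, Ne.symm h] using (hε ⟨(u, v), h⟩).1
      simp [hsgn, Sym2.eq_swap]
  · exact abs_units_mul_of_nonneg _ (hL _).1
  · rw [inflow, ← Finset.add_sum_erase _ _ (Finset.mem_univ u), hdiag, mul_zero, zero_add]
    refine hβ_sum u (fun w ↦ sgn (w, u)) fun w hw ↦ ?_
    have hwu : w ≠ u := fun h ↦ hw (h ▸ hβ_fix u u (by simp))
    have hβwu : β u w ≠ u := fun h ↦ hwu (by rw [← hβ u w, h, hβ_fix u u (by simp)])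
    simpa [sgn, hwu, hβwu] using (hε ⟨(w, u), hwu⟩).2 fun h ↦
      hw (congrArg Prod.fst (congrArg Subtype.val h))

end Balancing

section Monovary

variable {α ι κ : Type*} [LinearOrder ι] [LinearOrder κ]

theorem exists_perm_monovary [Finite α] (q : α → ι) (ℓ : α → κ) :
    ∃ π : Equiv.Perm α, Monovary q (ℓ ∘ π) := by
  obtain ⟨n, ⟨e⟩⟩ := Finite.exists_equiv_fin α
  have hq : Monotone (q ∘ e.symm ∘ Tuple.sort (q ∘ e.symm)) :=
    Tuple.monotone_sort (q ∘ e.symm)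
  have hℓ : Monotone (ℓ ∘ e.symm ∘ Tuple.sort (ℓ ∘ e.symm)) :=
    Tuple.monotone_sort (ℓ ∘ e.symm)
  let rank := e.trans (Tuple.sort (q ∘ e.symm)).symm
  refine ⟨rank.trans ((Tuple.sort (ℓ ∘ e.symm)).trans e.symm), ?_⟩
  simpa [rank, Function.comp_def] using (hq.monovary hℓ).comp_right rank

theorem exists_perm_monovaryOn (q : α → ι) (ℓ : α → κ) (S : Finset α) :
    ∃ π : Equiv.Perm α, (∀ a ∉ S, π a = a) ∧ MonovaryOn q (ℓ ∘ π) S := by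
  classical
  obtain ⟨π, hπ⟩ := exists_perm_monovary (fun a : S ↦ q a) (fun a ↦ ℓ a)
  refine ⟨π.ofSubtype, fun a ha ↦ Equiv.Perm.ofSubtype_apply_of_not_mem π ha,
    monovaryOn_iff_monovary.2 ?_⟩
  simpa [Function.comp_def] using hπ

theorem exists_bijOn_Ioc_monovaryOn (q : α → ι) (S : Finset α) (lo : ℤ) :
    ∃ ℓ : α → ℤ, Set.BijOn ℓ S (Set.Ioc lo (lo + S.card)) ∧ MonovaryOn q ℓ S := by
  obtain ⟨ℓ, hℓ⟩ := S.finite_toSet.exists_bijOn_of_encard_eq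
    (t := Set.Ioc lo (lo + S.card)) (by
      rw [← Finset.coe_Ioc, Set.encard_coe_eq_coe_finsetCard, Set.encard_coe_eq_coe_finsetCard]
      simp)
  obtain ⟨π, hπ, hmono⟩ := exists_perm_monovaryOn q ℓ S
  have hπS : Set.MapsTo π S S := fun a ha ↦ by
    by_contra hπa
    exact hπa ((π.injective (hπ (π a) hπa)).symm ▸ ha)
  exact ⟨ℓ ∘ π, hℓ.comp ((S.finite_toSet.injOn_iff_bijOn_of_mapsTo hπS).1 π.injective.injOn),
    hmono⟩

theorem injOn_add_of_monovaryOn {α : Type*} {S : Set α} {q ℓ : α → ℤ} (h : MonovaryOn q ℓ S)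
    (hℓ : Set.InjOn ℓ S) : Set.InjOn (fun a ↦ q a + ℓ a) S := by
  intro a ha b hb hab
  by_contra hne
  rcases (hℓ.ne ha hb hne).lt_or_gt with hlt | hlt
  · have := h ha hb hlt
    grind
  · have := h hb ha hlt
    grind

end Monovary

section SignedLabeling

variable {V : Type*} {G H : SimpleGraph V} {lo mid hi : ℤ} {f g : V × V → ℤ}

theorem bijOn_sym2Mk_of_anti (anti : ∀ d, f d.swap = -f d)
    (adj_iff : ∀ u v, G.Adj u v ↔ f (u, v) ≠ 0) :
    Set.BijOn (fun d ↦ s(d.1, d.2)) {d | 0 < f d} G.edgeSet := by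
  refine ⟨fun d hd ↦ (adj_iff d.1 d.2).2 (ne_of_gt hd), fun d hd d' hd' h ↦ ?_, fun e he ↦ ?_⟩
  · refine (Sym2.mk_eq_mk_iff.1 h).resolve_right fun hswap ↦ ?_
    have hneg := anti d'
    simp only [Set.mem_ofPred_eq] at hd hd'
    rw [← hswap] at hneg
    omega
  · induction e with
    | h u v =>
      have hanti := anti (u, v)
      rcases ((adj_iff u v).1 he).lt_or_gt with hneg | hpos
      · exact ⟨(v, u), by simp only [Set.mem_ofPred_eq]; simp at hanti; omega, Sym2.eq_swap⟩
      · exact ⟨(u, v), hpos, rfl⟩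

/-- An orientation of `G` together with a bijective labelling of its arcs by `lo < i ≤ hi`, encoded
by one antisymmetric function: `f (u, v) = i > 0` says that `uv` is an arc from `u` to `v` labelled
`i`, and then `f (v, u) = -i`; non-adjacent pairs get the value `0`. -/
structure IsSignedLabeling (G : SimpleGraph V) (lo hi : ℤ) (f : V × V → ℤ) : Prop where
  anti : ∀ d, f d.swap = -f d
  adj_iff : ∀ u v, G.Adj u v ↔ f (u, v) ≠ 0
  bijOn : Set.BijOn f {d | 0 < f d} (Set.Ioc lo hi)

namespace IsSignedLabeling

theorem apply_swap (hf : IsSignedLabeling G lo hi f) (u v : V) : f (u, v) = -f (v, u) :=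
  hf.anti (v, u)

theorem not_adj_iff (hf : IsSignedLabeling G lo hi f) (u v : V) : ¬ G.Adj u v ↔ f (u, v) = 0 := by
  rw [hf.adj_iff, not_not]

theorem bot : IsSignedLabeling (⊥ : SimpleGraph V) lo lo 0 where
  anti _ := rfl
  adj_iff _ _ := by simp
  bijOn := by simp

theorem neg (hf : IsSignedLabeling G lo hi f) : IsSignedLabeling G lo hi (-f) where
  anti d := congrArg Neg.neg (hf.anti d)
  adj_iff u v := by simp [hf.adj_iff u v]
  bijOn := by
    rw [show -f = f ∘ Equiv.prodComm V V from funext fun d ↦ (hf.anti d).symm]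
    exact hf.bijOn.comp ((Equiv.prodComm V V).bijOn fun _ ↦ Iff.rfl)

theorem comp (hf : IsSignedLabeling G lo hi f) (e : Equiv.Perm (V × V))
    (he : ∀ d, e d.swap = (e d).swap) (he₀ : ∀ d, f (e d) ≠ 0 ↔ f d ≠ 0) :
    IsSignedLabeling G lo hi (f ∘ e) where
  anti d := by simp only [Function.comp_apply, he, hf.anti]
  adj_iff u v := (hf.adj_iff u v).trans (he₀ (u, v)).symm
  bijOn := hf.bijOn.comp (e.bijOn fun _ ↦ Iff.rfl)

theorem sup (hf : IsSignedLabeling G lo mid f) (hg : IsSignedLabeling H mid hi g)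
    (hlo : lo ≤ mid) (hhi : mid ≤ hi) (hGH : Disjoint G H) :
    IsSignedLabeling (G ⊔ H) lo hi (f + g) := by
  have hfg : ∀ d, f d = 0 ∨ g d = 0 := fun ⟨u, v⟩ ↦ by
    rw [← hf.not_adj_iff, ← hg.not_adj_iff]
    exact imp_iff_not_or.1 (SimpleGraph.disjoint_left.1 hGH u v)
  have pos_eq : {d | 0 < (f + g) d} = {d | 0 < f d} ∪ {d | 0 < g d} := by
    ext d
    have := hfg d
    simp only [Set.mem_ofPred_eq, Pi.add_apply, Set.mem_union]
    omega
  have hf' : Set.BijOn (f + g) {d | 0 < f d} (Set.Ioc lo mid) := hf.bijOn.congr fun d hd ↦ by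
    simp [(hfg d).resolve_left (ne_of_gt hd)]
  have hg' : Set.BijOn (f + g) {d | 0 < g d} (Set.Ioc mid hi) := hg.bijOn.congr fun d hd ↦ by
    simp [(hfg d).resolve_right (ne_of_gt hd)]
  refine ⟨fun d ↦ ?_, fun u v ↦ ?_, ?_⟩
  · simp only [Pi.add_apply, hf.anti, hg.anti, neg_add]
  · have := hfg (u, v)
    rw [SimpleGraph.sup_adj, hf.adj_iff, hg.adj_iff, Pi.add_apply]
    omega
  · rw [pos_eq, ← Set.Ioc_union_Ioc_eq_Ioc hlo hhi]
    have hdisj : Disjoint {d | 0 < f d} {d | 0 < g d} := Set.disjoint_left.2 fun d hd hd' ↦ by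
      rcases hfg d with h | h <;> simp [h] at hd hd'
    refine hf'.union hg' ((Set.injOn_union hdisj).2 ⟨hf'.injOn, hg'.injOn, fun d hd d' hd' ↦ ?_⟩)
    exact ((hf'.mapsTo hd).2.trans_lt (hg'.mapsTo hd').1).ne

theorem card_edgeFinset [Fintype G.edgeSet] (hf : IsSignedLabeling G lo hi f) (h : lo ≤ hi) :
    (G.edgeFinset.card : ℤ) = hi - lo := by
  have hcard : G.edgeSet.ncard = (Set.Ioc lo hi).ncard :=
    (bijOn_sym2Mk_of_anti hf.anti hf.adj_iff).ncard_eq.symm.trans hf.bijOn.ncard_eq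
  rw [← Finset.coe_Ioc, Set.ncard_coe_finset, Int.card_Ioc, ← SimpleGraph.coe_edgeFinset,
    Set.ncard_coe_finset] at hcard
  omega

end IsSignedLabeling

variable [Fintype V]

theorem inflow_add (f g : V × V → ℤ) (u : V) : inflow (f + g) u = inflow f u + inflow g u :=
  Finset.sum_add_distrib

theorem inflow_neg (f : V × V → ℤ) (u : V) : inflow (-f) u = -inflow f u :=
  Finset.sum_neg_distrib _

theorem exists_isSignedLabeling_abs_inflow_le (G : SimpleGraph V) (hlo : 0 ≤ lo) :
    ∃ hi f, lo ≤ hi ∧ IsSignedLabeling G lo hi f ∧ ∀ u, |inflow f u| ≤ hi := by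
  classical
  obtain ⟨ℓ, hℓ, -⟩ := exists_bijOn_Ioc_monovaryOn (0 : Sym2 V → ℤ) G.edgeFinset lo
  rw [SimpleGraph.coe_edgeFinset] at hℓ
  let L : Sym2 V → ℤ := fun e ↦ if e ∈ G.edgeSet then ℓ e else 0
  have hL (e : Sym2 V) : L e ∈ Set.Icc 0 (lo + G.edgeFinset.card) ∧ (e ∈ G.edgeSet ↔ L e ≠ 0) := by
    by_cases he : e ∈ G.edgeSet
    · obtain ⟨hlt, hle⟩ := hℓ.mapsTo he
      simp only [L, he, if_true]
      exact ⟨⟨by omega, hle⟩, iff_of_true trivial (by omega)⟩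
    · simp only [L, he, if_false]
      exact ⟨⟨le_rfl, by omega⟩, by simp⟩
  obtain ⟨f, anti, abs_eq, hbound⟩ := exists_balanced_flow L (W := lo + G.edgeFinset.card)
    (by omega) (fun e ↦ (hL e).1) (fun v ↦ by simp [L])
  have adj_iff (u v : V) : G.Adj u v ↔ f (u, v) ≠ 0 := by
    rw [← abs_ne_zero, abs_eq, ← (hL _).2, SimpleGraph.mem_edgeSet]
  have hbij : Set.BijOn (fun d : V × V ↦ s(d.1, d.2)) {d | 0 < f d} G.edgeSet :=
    bijOn_sym2Mk_of_anti anti adj_iff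
  refine ⟨_, f, by omega, ⟨anti, adj_iff, (hℓ.comp hbij).congr fun d hd ↦ ?_⟩, hbound⟩
  have hpos : |f d| = f d := abs_of_pos hd
  rw [← hpos, abs_eq]
  exact (if_pos (hbij.mapsTo hd)).symm

theorem vertexSum_toNat (anti : ∀ d, f d.swap = -f d) (u : V) :
    vertexSum ⟨fun v w ↦ 0 < f (v, w)⟩ (fun d ↦ (f d).toNat) u = inflow f u := by
  rw [vertexSum, inflow, Finset.sum_filter, Finset.sum_filter, ← Finset.sum_sub_distrib]
  refine Finset.sum_congr rfl fun w _ ↦ ?_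
  have hanti : f (u, w) = -f (w, u) := anti (w, u)
  split_ifs <;> omega

theorem IsSignedLabeling.admitsAntimagicOrientation (hf : IsSignedLabeling G 0 hi f)
    (hinj : Function.Injective (inflow f)) : AdmitsAntimagicOrientation G := by
  let D : Digraph V := ⟨fun u v ↦ 0 < f (u, v)⟩
  have harc : arcSet D = {d | 0 < f d} := rfl
  refine ⟨D, fun d ↦ (f d).toNat, ⟨fun u v ↦ ?_, fun u v ↦ ?_⟩, ?_, fun u v huv ↦ ?_⟩
  · rw [hf.adj_iff]
    have := hf.apply_swap u v
    simp only [D]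
    omega
  · have := hf.apply_swap u v
    simp only [D]
    omega
  · have hcard : (arcSet D).ncard = hi.toNat := by
      rw [harc, hf.bijOn.ncard_eq, ← Finset.coe_Ioc, Set.ncard_coe_finset, Int.card_Ioc, sub_zero]
    have htoNat : Set.BijOn Int.toNat (Set.Ioc 0 hi) (Set.Icc 1 hi.toNat) := by
      refine ⟨fun i hi ↦ ?_, fun i hi j hj h ↦ ?_, fun n hn ↦ ⟨n, ?_, by simp⟩⟩ <;>
        simp only [Set.mem_Icc, Set.mem_Ioc] at * <;> omega
    rw [hcard]
    exact htoNat.comp hf.bijOn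
  · rw [vertexSum_toNat hf.anti, vertexSum_toNat hf.anti]
    exact hinj.ne huv

end SignedLabeling

section ParentGraph

variable {V : Type*} {S : Finset V} {par : V → V} {c : V → ℤ} {lo hi : ℤ}

/-- The graph joining every vertex of `S` to its parent. -/
def parentGraph (S : Finset V) (par : V → V) : SimpleGraph V :=
  .fromRel fun u v ↦ v ∈ S ∧ par v = u

open scoped Classical in
/-- The flow sending `c v` units from the parent of `v` to `v`, for every `v ∈ S`. -/
noncomputable def parentFlow (S : Finset V) (par : V → V) (c : V → ℤ) (d : V × V) : ℤ :=
  (if d.2 ∈ S ∧ par d.2 = d.1 then c d.2 else 0) - if d.1 ∈ S ∧ par d.1 = d.2 then c d.1 else 0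

theorem parentGraph_le {G : SimpleGraph V} (h : ∀ v ∈ S, G.Adj (par v) v) :
    parentGraph S par ≤ G := by
  rintro u v ⟨-, ⟨hv, rfl⟩ | ⟨hu, rfl⟩⟩
  · exact h v hv
  · exact (h u hu).symm

theorem parentGraph_adj (hpar : ∀ v ∈ S, par v ∉ S) {v : V} (hv : v ∈ S) :
    (parentGraph S par).Adj (par v) v :=
  ⟨fun h ↦ hpar v hv (h.symm ▸ hv), .inl ⟨hv, rfl⟩⟩

theorem parentFlow_apply (hpar : ∀ v ∈ S, par v ∉ S) {v : V} (hv : v ∈ S) :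
    parentFlow S par c (par v, v) = c v := by
  simp [parentFlow, hv, hpar v hv]

theorem parentFlow_eq_zero {u v : V} (huv : v ∈ S → par v ≠ u) (hvu : u ∈ S → par u ≠ v) :
    parentFlow S par c (u, v) = 0 := by
  grind [parentFlow]

theorem parentFlow_swap (d : V × V) : parentFlow S par c d.swap = -parentFlow S par c d :=
  (neg_sub _ _).symm

theorem isSignedLabeling_parentFlow (hpar : ∀ v ∈ S, par v ∉ S) (hlo : 0 ≤ lo)
    (hc : Set.BijOn c S (Set.Ioc lo hi)) :
    IsSignedLabeling (parentGraph S par) lo hi (parentFlow S par c) := by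
  have hc_pos (v : V) (hv : v ∈ S) : 0 < c v := hlo.trans_lt (hc.mapsTo hv).1
  have hpos : {d | 0 < parentFlow S par c d} = (fun v ↦ (par v, v)) '' S := by
    ext ⟨u, v⟩
    simp only [parentFlow, Set.mem_ofPred_eq, Set.mem_image, SetLike.mem_coe, Prod.mk.injEq]
    grind
  have hcomp : Set.EqOn (parentFlow S par c ∘ fun v ↦ (par v, v)) c S := fun v hv ↦
    parentFlow_apply hpar hv
  refine ⟨parentFlow_swap, fun u v ↦ ?_, ?_⟩
  · simp only [parentGraph, parentFlow, SimpleGraph.fromRel_adj]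
    grind
  · have hc' := hc.congr hcomp.symm
    rw [hpos]
    refine ⟨Set.mapsTo_image_iff.2 hc'.mapsTo, hc'.injOn.image_of_comp, ?_⟩
    rw [Set.SurjOn, ← Set.image_comp]
    exact hc'.surjOn

theorem inflow_parentFlow [Fintype V] [DecidableEq V] (u : V) :
    inflow (parentFlow S par c) u = (if u ∈ S then c u else 0) - ∑ v ∈ S with par v = u, c v := by
  simp only [inflow, parentFlow, Finset.sum_sub_distrib]
  congr 1
  · by_cases hu : u ∈ S <;> simp [hu]
  · rw [← Finset.sum_filter]
    congr 1
    ext v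
    simp

end ParentGraph

section Layers

variable {V : Type*} {G P : SimpleGraph V} {X : Finset V} {par : V → V} {k M : ℤ}
  {f g : V × V → ℤ}

/-- `par` assigns to every vertex outside `X` a neighbour that is closer to `X`, in such a way that
`X` is reached after at most two steps; the values of `par` on `X` are irrelevant. -/
structure IsParentMap (G : SimpleGraph V) (X : Finset V) (par : V → V) : Prop where
  adj : ∀ v ∉ X, G.Adj (par v) v
  par_mem : ∀ v ∉ X, (∃ x ∈ X, G.Adj x v) → par v ∈ X
  par_par_mem : ∀ v ∉ X, par v ∉ X → par (par v) ∈ X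

variable [Fintype V]

open scoped Classical in
/-- The vertices at distance one from `X` in the forest described by the parent map `par`. -/
noncomputable def innerLayer (X : Finset V) (par : V → V) : Finset V := {v | v ∉ X ∧ par v ∈ X}

open scoped Classical in
/-- The vertices at distance two from `X` in the forest described by the parent map `par`. -/
noncomputable def outerLayer (X : Finset V) (par : V → V) : Finset V := {v | v ∉ X ∧ par v ∉ X}

open scoped Classical in
/-- The vertices outside `X` whose parent is `u`. -/
noncomputable def children (X : Finset V) (par : V → V) (u : V) : Finset V :=
  {v | v ∉ X ∧ par v = u}

@[simp]
theorem mem_innerLayer {v : V} : v ∈ innerLayer X par ↔ v ∉ X ∧ par v ∈ X := by simp [innerLayer]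

@[simp]
theorem mem_outerLayer {v : V} : v ∈ outerLayer X par ↔ v ∉ X ∧ par v ∉ X := by simp [outerLayer]

@[simp]
theorem mem_children {u v : V} : v ∈ children X par u ↔ v ∉ X ∧ par v = u := by simp [children]

/-- The forest in which every vertex outside `X` is joined to its parent. -/
noncomputable def parentForest (X : Finset V) (par : V → V) : SimpleGraph V :=
  parentGraph (outerLayer X par) par ⊔ parentGraph (innerLayer X par) par

/-- The flow `f` extended to the parent forest: the edges from the outer to the inner layer carry
`c₂` towards the inner layer, those from `X` to the inner layer carry `c₁` away from `X`. -/
noncomputable def layeredFlow (X : Finset V) (par : V → V) (f : V × V → ℤ) (c₁ c₂ : V → ℤ) :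
    V × V → ℤ :=
  f - parentFlow (outerLayer X par) par c₂ + parentFlow (innerLayer X par) par c₁

theorem children_subset_innerLayer {x : V} (hx : x ∈ X) : children X par x ⊆ innerLayer X par := by
  intro v hv
  obtain ⟨hvX, rfl⟩ := mem_children.1 hv
  exact mem_innerLayer.2 ⟨hvX, hx⟩

theorem children_subset_outerLayer {u : V} (hu : u ∉ X) : children X par u ⊆ outerLayer X par := by
  intro v hv
  obtain ⟨hvX, rfl⟩ := mem_children.1 hv
  exact mem_outerLayer.2 ⟨hvX, hu⟩

theorem card_innerLayer_add_card_outerLayer (X : Finset V) (par : V → V) :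
    (innerLayer X par).card + (outerLayer X par).card + X.card = Fintype.card V := by
  classical
  have h : (innerLayer X par).card + (outerLayer X par).card = Xᶜ.card := by
    rw [← Finset.card_filter_add_card_filter_not (s := Xᶜ) fun v ↦ par v ∈ X]
    congr 2 <;> ext v <;> simp
  rw [h, Finset.card_compl, Nat.sub_add_cancel X.card_le_univ]

/-- A signed labelling of `G` in layers: the edges of `G` that do not join a vertex to its parent
get labels up to `M` (prescribed where `g` is nonzero), then come the edges from the outer to the
inner layer, oriented towards the inner layer, and the largest labels are on the edges from `X` to
the inner layer, oriented away from `X`. Within both layers the labels are sorted so that the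
vertex-sums become distinct. -/
structure IsLayeredLabeling (G : SimpleGraph V) (X : Finset V) (par : V → V) (g : V × V → ℤ)
    (M : ℤ) (f : V × V → ℤ) : Prop where
  nonneg : 0 ≤ M
  isSignedLabeling :
    IsSignedLabeling G 0 (M + (outerLayer X par).card + (innerLayer X par).card) f
  apply_eq : ∀ d, g d ≠ 0 → f d = g d
  lt_apply : ∀ v ∈ innerLayer X par, M + (outerLayer X par).card < f (par v, v)
  monovaryOn : MonovaryOn (fun v ↦ inflow f v - f (par v, v)) (fun v ↦ f (par v, v))
    (innerLayer X par)
  inflow_nonneg : ∀ v ∈ innerLayer X par, 0 ≤ inflow f v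
  inflow_mem_Ico : ∀ v ∈ outerLayer X par,
    inflow f v ∈ Set.Ico (-(2 * M + (outerLayer X par).card)) 0
  injOn_outerLayer : Set.InjOn (inflow f) (outerLayer X par)
  inflow_le : ∀ x ∈ X, inflow f x ≤ inflow g x + M - ∑ v ∈ children X par x, f (x, v)

theorem exists_extension_abs_inflow_sub_le {H : SimpleGraph V} (hg : IsSignedLabeling P 0 k g)
    (hk : 0 ≤ k) (hP : P ≤ H) :
    ∃ M f, k ≤ M ∧ IsSignedLabeling H 0 M f ∧ (∀ d, g d ≠ 0 → f d = g d) ∧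
      ∀ u, |inflow f u - inflow g u| ≤ M := by
  obtain ⟨M, r, hkM, hr, hbound⟩ := exists_isSignedLabeling_abs_inflow_le (H \ P) hk
  refine ⟨M, g + r, hkM, ?_, fun d hd ↦ ?_, fun u ↦ ?_⟩
  · simpa only [sup_sdiff_cancel_right hP] using hg.sup hr hk hkM disjoint_sdiff_self_right
  · have hPd : P.Adj d.1 d.2 := (hg.adj_iff d.1 d.2).2 hd
    have hrd : r d = 0 := (hr.not_adj_iff d.1 d.2).1 fun h ↦ h.2 hPd
    simp only [Pi.add_apply, hrd, add_zero]
  · simpa only [inflow_add, add_sub_cancel_left] using hbound u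

theorem par_notMem_innerLayer {v : V} (hv : v ∈ innerLayer X par) : par v ∉ innerLayer X par :=
  fun h ↦ (mem_innerLayer.1 h).1 (mem_innerLayer.1 hv).2

namespace IsParentMap

theorem par_mem_innerLayer (hpar : IsParentMap G X par) {v : V} (hv : v ∈ outerLayer X par) :
    par v ∈ innerLayer X par := by
  obtain ⟨hvX, hparX⟩ := mem_outerLayer.1 hv
  exact mem_innerLayer.2 ⟨hparX, hpar.par_par_mem v hvX hparX⟩

theorem notMem_outerLayer (hpar : IsParentMap G X par) {v : V} (hv : v ∈ outerLayer X par) :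
    par v ∉ outerLayer X par := fun h ↦
  (mem_outerLayer.1 h).2 (mem_innerLayer.1 (hpar.par_mem_innerLayer hv)).2

theorem isSignedLabeling_layeredFlow (hpar : IsParentMap G X par)
    (hf : IsSignedLabeling (G \ parentForest X par) 0 M f) (hM : 0 ≤ M) {c₁ c₂ : V → ℤ}
    (hc₂ : Set.BijOn c₂ (outerLayer X par) (Set.Ioc M (M + (outerLayer X par).card)))
    (hc₁ : Set.BijOn c₁ (innerLayer X par) (Set.Ioc (M + (outerLayer X par).card)
      (M + (outerLayer X par).card + (innerLayer X par).card))) :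
    IsSignedLabeling G 0 (M + (outerLayer X par).card + (innerLayer X par).card)
      (layeredFlow X par f c₁ c₂) := by
  have hforest : parentForest X par ≤ G :=
    sup_le (parentGraph_le fun v hv ↦ hpar.adj v (mem_outerLayer.1 hv).1)
      (parentGraph_le fun v hv ↦ hpar.adj v (mem_innerLayer.1 hv).1)
  have hlayers : Disjoint (parentGraph (outerLayer X par) par)
      (parentGraph (innerLayer X par) par) := SimpleGraph.disjoint_left.2 fun u v h₂ h₁ ↦ by
    simp only [parentGraph, SimpleGraph.fromRel_adj, mem_outerLayer, mem_innerLayer] at h₁ h₂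
    grind
  have hdisj : Disjoint (G \ parentForest X par) (parentForest X par) := disjoint_sdiff_self_left
  have hG : G \ parentForest X par ⊔ parentGraph (outerLayer X par) par ⊔
      parentGraph (innerLayer X par) par = G := by
    rw [sup_assoc, ← parentForest, sdiff_sup_cancel hforest]
  have hf₂ := (isSignedLabeling_parentFlow (fun _ ↦ hpar.notMem_outerLayer) hM hc₂).neg
  have hf₁ := isSignedLabeling_parentFlow (fun _ ↦ par_notMem_innerLayer) (by omega) hc₁
  have hsup := (hf.sup hf₂ hM (by omega) (hdisj.mono_right le_sup_left)).sup hf₁ (by omega)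
    (by omega) (Disjoint.sup_left (hdisj.mono_right le_sup_right) hlayers)
  rwa [hG, ← sub_eq_add_neg] at hsup

end IsParentMap

section LayeredFlow

variable (f : V × V → ℤ) (c₁ c₂ : V → ℤ)

theorem inflow_layeredFlow [DecidableEq V] (u : V) :
    inflow (layeredFlow X par f c₁ c₂) u = inflow f u -
      ((if u ∈ outerLayer X par then c₂ u else 0) - ∑ v ∈ outerLayer X par with par v = u, c₂ v) +
      ((if u ∈ innerLayer X par then c₁ u else 0) -
        ∑ v ∈ innerLayer X par with par v = u, c₁ v) := by
  rw [layeredFlow, sub_eq_add_neg, inflow_add, inflow_add, inflow_neg, inflow_parentFlow,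
    inflow_parentFlow]
  ring

theorem inflow_layeredFlow_of_mem {x : V} (hx : x ∈ X) :
    inflow (layeredFlow X par f c₁ c₂) x = inflow f x - ∑ v ∈ children X par x, c₁ v := by
  classical
  have houter : {v ∈ outerLayer X par | par v = x} = ∅ := by
    ext v
    grind [mem_outerLayer]
  have hinner : {v ∈ innerLayer X par | par v = x} = children X par x := by
    ext v
    grind [mem_innerLayer, mem_children]
  rw [inflow_layeredFlow, houter, hinner]
  simp [hx, sub_eq_add_neg]

theorem inflow_layeredFlow_of_notMem [DecidableEq V] {v : V} (hv : v ∉ X) :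
    inflow (layeredFlow X par f c₁ c₂) v =
      inflow f v + ∑ w ∈ children X par v, c₂ w +
        if v ∈ innerLayer X par then c₁ v else -c₂ v := by
  have houter : {w ∈ outerLayer X par | par w = v} = children X par v := by
    ext w
    grind [mem_outerLayer, mem_children]
  have hinner : {w ∈ innerLayer X par | par w = v} = ∅ := by
    ext w
    grind [mem_innerLayer]
  rw [inflow_layeredFlow, houter, hinner]
  simp only [mem_innerLayer, mem_outerLayer, hv, not_false_eq_true, true_and, ite_not,
    Finset.sum_empty, sub_zero]
  split_ifs <;> ring

theorem IsParentMap.inflow_layeredFlow_of_mem_outerLayer (hpar : IsParentMap G X par) {v : V}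
    (hv : v ∈ outerLayer X par) :
    inflow (layeredFlow X par f c₁ c₂) v = inflow f v - c₂ v := by
  classical
  obtain ⟨hvX, hparX⟩ := mem_outerLayer.1 hv
  have hchildren : children X par v = ∅ := by
    ext w
    grind [hpar.par_par_mem w, mem_children]
  rw [inflow_layeredFlow_of_notMem f c₁ c₂ hvX, hchildren]
  simp [hparX, sub_eq_add_neg]

variable {f c₁ c₂}

theorem layeredFlow_apply_of_mem_innerLayer {v : V} (hv : v ∈ innerLayer X par)
    (hf : f (par v, v) = 0) :
    layeredFlow X par f c₁ c₂ (par v, v) = c₁ v := by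
  have hparX : par v ∈ X := (mem_innerLayer.1 hv).2
  have h₂ : parentFlow (outerLayer X par) par c₂ (par v, v) = 0 :=
    parentFlow_eq_zero (fun h ↦ absurd hparX (mem_outerLayer.1 h).2)
      (fun h ↦ absurd hparX (mem_outerLayer.1 h).1)
  simp [layeredFlow, h₂, hf, parentFlow_apply (fun _ ↦ par_notMem_innerLayer) hv]

theorem layeredFlow_apply_of_sdiff_adj {u v : V} (h : (G \ parentForest X par).Adj u v) :
    layeredFlow X par f c₁ c₂ (u, v) = f (u, v) := by
  obtain ⟨hG, hnot⟩ := h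
  have h₂ : parentFlow (outerLayer X par) par c₂ (u, v) = 0 :=
    parentFlow_eq_zero (fun hv h ↦ hnot (.inl ⟨hG.ne, .inl ⟨hv, h⟩⟩))
      fun hu h ↦ hnot (.inl ⟨hG.ne, .inr ⟨hu, h⟩⟩)
  have h₁ : parentFlow (innerLayer X par) par c₁ (u, v) = 0 :=
    parentFlow_eq_zero (fun hv h ↦ hnot (.inr ⟨hG.ne, .inl ⟨hv, h⟩⟩))
      fun hu h ↦ hnot (.inr ⟨hG.ne, .inr ⟨hu, h⟩⟩)
  simp only [layeredFlow, Pi.add_apply, Pi.sub_apply, h₁, h₂, sub_zero, add_zero]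

theorem IsParentMap.isLayeredLabeling_layeredFlow (hpar : IsParentMap G X par)
    (hf : IsSignedLabeling (G \ parentForest X par) 0 M f) (hM : 0 ≤ M)
    (hfg : ∀ d, g d ≠ 0 → f d = g d) (hbound : ∀ u, |inflow f u - inflow g u| ≤ M)
    (hg_inner : ∀ v ∈ innerLayer X par, 0 ≤ inflow g v)
    (hg_outer : ∀ v ∈ outerLayer X par, inflow g v = 0)
    (hc₂ : Set.BijOn c₂ (outerLayer X par) (Set.Ioc M (M + (outerLayer X par).card)))
    (hc₂_mono : MonovaryOn (fun v ↦ -inflow f v) c₂ (outerLayer X par))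
    (hc₁ : Set.BijOn c₁ (innerLayer X par) (Set.Ioc (M + (outerLayer X par).card)
      (M + (outerLayer X par).card + (innerLayer X par).card)))
    (hc₁_mono : MonovaryOn (fun v ↦ inflow f v + ∑ w ∈ children X par v, c₂ w) c₁
      (innerLayer X par)) :
    IsLayeredLabeling G X par g M
      (layeredFlow X par f c₁ c₂) := by
  classical
  have f_zero : ∀ v ∈ innerLayer X par, f (par v, v) = 0 := fun v hv ↦
    (hf.not_adj_iff _ _).1 fun h ↦
      h.2 (.inr (parentGraph_adj (fun _ ↦ par_notMem_innerLayer) hv))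
  have apply_par (v) (hv : v ∈ innerLayer X par) := layeredFlow_apply_of_mem_innerLayer
    (c₁ := c₁) (c₂ := c₂) hv (f_zero v hv)
  have inflow_inner (v) (hv : v ∈ innerLayer X par) := by
    simpa only [hv, if_true] using inflow_layeredFlow_of_notMem (par := par) f c₁ c₂
      (mem_innerLayer.1 hv).1
  have inflow_outer (v) (hv : v ∈ outerLayer X par) :=
    hpar.inflow_layeredFlow_of_mem_outerLayer f c₁ c₂ hv
  refine ⟨hM, hpar.isSignedLabeling_layeredFlow hf hM hc₂ hc₁, fun ⟨u, v⟩ hd ↦ ?_, fun v hv ↦ ?_,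
    fun v hv w hw hvw ↦ ?_, fun v hv ↦ ?_, fun v hv ↦ ?_, fun v hv w hw hvw ↦ ?_, fun x hx ↦ ?_⟩
  · rw [layeredFlow_apply_of_sdiff_adj ((hf.adj_iff u v).2 (hfg _ hd ▸ hd)), hfg _ hd]
  · rw [apply_par v hv]
    exact (hc₁.mapsTo hv).1
  · simp only [apply_par v hv, apply_par w hw, inflow_inner v hv, inflow_inner w hw,
      add_sub_cancel_right] at hvw ⊢
    exact hc₁_mono hv hw hvw
  · have hsum : 0 ≤ ∑ w ∈ children X par v, c₂ w := Finset.sum_nonneg fun w hw ↦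
      hM.trans (hc₂.mapsTo (children_subset_outerLayer (mem_innerLayer.1 hv).1 hw)).1.le
    have := abs_le.1 (hbound v)
    have := hg_inner v hv
    have := (hc₁.mapsTo hv).1
    rw [inflow_inner v hv]
    omega
  · have := abs_le.1 (hbound v)
    have := hg_outer v hv
    have := hc₂.mapsTo hv
    rw [inflow_outer v hv]
    simp only [Set.mem_Ico, Set.mem_Ioc] at this ⊢
    omega
  · refine injOn_add_of_monovaryOn hc₂_mono hc₂.injOn hv hw ?_
    simp only [inflow_outer v hv, inflow_outer w hw] at hvw
    change -inflow f v + c₂ v = -inflow f w + c₂ w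
    omega
  · have hsum : ∑ v ∈ children X par x, c₁ v =
        ∑ v ∈ children X par x, layeredFlow X par f c₁ c₂ (x, v) :=
      Finset.sum_congr rfl fun v hv ↦ by
        rw [← apply_par v (children_subset_innerLayer hx hv), (mem_children.1 hv).2]
    have := abs_le.1 (hbound x)
    rw [inflow_layeredFlow_of_mem f c₁ c₂ hx, ← hsum]
    omega

end LayeredFlow

theorem IsParentMap.exists_isLayeredLabeling (hpar : IsParentMap G X par)
    (hg : IsSignedLabeling P 0 k g) (hk : 0 ≤ k) (hPG : P ≤ G)
    (hP : ∀ v ∉ X, ¬ P.Adj (par v) v) (hg_inner : ∀ v ∈ innerLayer X par, 0 ≤ inflow g v)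
    (hg_outer : ∀ v ∈ outerLayer X par, inflow g v = 0) :
    ∃ M f, IsLayeredLabeling G X par g M f := by
  have hPT : Disjoint P (parentForest X par) :=
    SimpleGraph.disjoint_left.2 fun u v huv ↦ by
      rintro (⟨-, ⟨hv, rfl⟩ | ⟨hu, rfl⟩⟩ | ⟨-, ⟨hv, rfl⟩ | ⟨hu, rfl⟩⟩)
      · exact hP v (mem_outerLayer.1 hv).1 huv
      · exact hP u (mem_outerLayer.1 hu).1 huv.symm
      · exact hP v (mem_innerLayer.1 hv).1 huv
      · exact hP u (mem_innerLayer.1 hu).1 huv.symm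
  obtain ⟨M, f, hkM, hf, hfg, hbound⟩ := exists_extension_abs_inflow_sub_le hg hk
    (le_sdiff.2 ⟨hPG, hPT⟩)
  have hM := hk.trans hkM
  obtain ⟨c₂, hc₂, hc₂_mono⟩ := exists_bijOn_Ioc_monovaryOn (fun v ↦ -inflow f v)
    (outerLayer X par) M
  obtain ⟨c₁, hc₁, hc₁_mono⟩ := exists_bijOn_Ioc_monovaryOn
    (fun v ↦ inflow f v + ∑ w ∈ children X par v, c₂ w) (innerLayer X par)
    (M + (outerLayer X par).card)
  exact ⟨M, _, hpar.isLayeredLabeling_layeredFlow hf hM hfg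
    hbound hg_inner hg_outer hc₂ hc₂_mono hc₁ hc₁_mono⟩

end Layers

section Separation

variable {V : Type*} {X : Finset V} {B : ℤ} {s s' : V → ℤ}

/-- The values of `s` outside `X` are pairwise distinct and at least `B`. For vertex-sums this means
that only the vertices of `X` are left to be taken care of, once their sums are below `B`. -/
structure IsSeparatedOutside (X : Finset V) (B : ℤ) (s : V → ℤ) : Prop where
  injOn : Set.InjOn s (X : Set V)ᶜ
  le : ∀ v ∉ X, B ≤ s v

namespace IsSeparatedOutside

theorem congr (hs : IsSeparatedOutside X B s) (h : ∀ v ∉ X, s' v = s v) :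
    IsSeparatedOutside X B s' :=
  ⟨hs.injOn.congr fun v hv ↦ (h v hv).symm, fun v hv ↦ (hs.le v hv).trans_eq (h v hv).symm⟩

theorem of_swap [DecidableEq V] (hs : IsSeparatedOutside X B s) {a b : V} (ha : a ∉ X)
    (hb : b ∉ X) (h : ∀ v ∉ X, s' v = s (Equiv.swap a b v)) : IsSeparatedOutside X B s' := by
  have hswap (v : V) (hv : v ∉ X) : Equiv.swap a b v ∉ X := by
    rw [Equiv.swap_apply_def]
    split_ifs <;> assumption
  have hs' : IsSeparatedOutside X B (s ∘ Equiv.swap a b) :=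
    ⟨hs.injOn.comp (Equiv.injective _).injOn hswap, fun v hv ↦ hs.le _ (hswap v hv)⟩
  exact hs'.congr h

theorem of_add_one_sub_one (hs : IsSeparatedOutside X B s) {a b : V} (ha : a ∉ X) (hb : b ∉ X)
    (hab : s a < s b) (hab₂ : s b - s a ≠ 2) (hbetween : ∀ v ∉ X, s v ≤ s a ∨ s b ≤ s v)
    (ha' : s' a = s a + 1) (hb' : s' b = s b - 1) (h : ∀ v ∉ X, v ≠ a → v ≠ b → s' v = s v) :
    IsSeparatedOutside X B s' := by
  have hother (v : V) (hv : v ∉ X) (hva : v ≠ a) (hvb : v ≠ b) : s v < s a ∨ s b < s v := by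
    have := mt (hs.injOn hv ha) hva
    have := mt (hs.injOn hv hb) hvb
    have := hbetween v hv
    omega
  refine ⟨fun v hv w hw hvw ↦ ?_, fun v hv ↦ ?_⟩
  · by_cases hva : v = a <;> by_cases hvb : v = b <;> by_cases hwa : w = a <;>
      by_cases hwb : w = b <;> grind [hs.injOn hv hw]
  · have := hs.le v hv
    have := hs.le a ha
    by_cases hva : v = a
    · grind
    · by_cases hvb : v = b <;> grind

end IsSeparatedOutside

theorem IsSignedLabeling.admitsAntimagicOrientation_of_lt [Fintype V] {G : SimpleGraph V} {hi : ℤ}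
    {f : V × V → ℤ} (hf : IsSignedLabeling G 0 hi f) (hs : IsSeparatedOutside X B (inflow f))
    (hlt : ∀ x ∈ X, inflow f x < B) (hinj : Set.InjOn (inflow f) X) :
    AdmitsAntimagicOrientation G := by
  refine hf.admitsAntimagicOrientation (Set.injOn_univ.1 ?_)
  rw [← Set.union_compl_self (X : Set V), Set.injOn_union disjoint_compl_right]
  exact ⟨hinj, hs.injOn, fun x hx v hv ↦ ((hlt x hx).trans_le (hs.le v hv)).ne⟩

end Separation

namespace IsLayeredLabeling

variable {V : Type*} [Fintype V] {G : SimpleGraph V} {X : Finset V} {par : V → V}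
  {g f : V × V → ℤ} {M : ℤ} {a b : V}

theorem pos_apply (hf : IsLayeredLabeling G X par g M f) (ha : a ∈ innerLayer X par) :
    0 < f (par a, a) := by
  have := hf.nonneg
  have := hf.lt_apply a ha
  omega

theorem apply_inj (hf : IsLayeredLabeling G X par g M f) (ha : a ∈ innerLayer X par)
    (hb : b ∈ innerLayer X par) (h : f (par a, a) = f (par b, b)) : a = b :=
  (Prod.ext_iff.1 (hf.isSignedLabeling.bijOn.injOn (hf.pos_apply ha) (hf.pos_apply hb) h)).2

theorem inflow_lt_inflow (hf : IsLayeredLabeling G X par g M f) (ha : a ∈ innerLayer X par)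
    (hb : b ∈ innerLayer X par) (h : f (par a, a) < f (par b, b)) : inflow f a < inflow f b := by
  have : inflow f a - f (par a, a) ≤ inflow f b - f (par b, b) := hf.monovaryOn ha hb h
  omega

theorem mem_innerLayer_or_mem_outerLayer {v : V} (hv : v ∉ X) :
    v ∈ innerLayer X par ∨ v ∈ outerLayer X par := by
  simp [hv, em]

theorem isSeparatedOutside (hf : IsLayeredLabeling G X par g M f) :
    IsSeparatedOutside X (-(2 * M + (outerLayer X par).card)) (inflow f) := by
  have hcompl : (X : Set V)ᶜ = ↑(innerLayer X par) ∪ ↑(outerLayer X par) := by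
    ext v
    simp [← and_or_left, em]
  have := hf.nonneg
  refine ⟨?_, fun v hv ↦ ?_⟩
  · have hdisj : Disjoint (innerLayer X par : Set V) (outerLayer X par) :=
      Set.disjoint_left.2 fun v hv hv' ↦ (mem_outerLayer.1 hv').2 (mem_innerLayer.1 hv).2
    rw [hcompl, Set.injOn_union hdisj]
    refine ⟨fun v hv w hw h ↦ ?_, hf.injOn_outerLayer, fun v hv w hw ↦
      ((hf.inflow_mem_Ico w hw).2.trans_le (hf.inflow_nonneg v hv)).ne'⟩
    refine hf.apply_inj hv hw (le_antisymm ?_ ?_) <;> refine not_lt.1 fun hlt ↦ ?_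
    · exact (hf.inflow_lt_inflow hw hv hlt).ne' h
    · exact (hf.inflow_lt_inflow hv hw hlt).ne h
  · rcases mem_innerLayer_or_mem_outerLayer (par := par) hv with h | h
    · have := hf.inflow_nonneg v h
      omega
    · exact (hf.inflow_mem_Ico v h).1

theorem inflow_le_or_le (hf : IsLayeredLabeling G X par g M f) (ha : a ∈ innerLayer X par)
    (hb : b ∈ innerLayer X par) (h : f (par b, b) = f (par a, a) + 1) {v : V} (hv : v ∉ X) :
    inflow f v ≤ inflow f a ∨ inflow f b ≤ inflow f v := by
  rcases mem_innerLayer_or_mem_outerLayer (par := par) hv with hv | hv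
  · rcases lt_trichotomy (f (par v, v)) (f (par a, a)) with hlt | heq | hgt
    · exact .inl (hf.inflow_lt_inflow hv ha hlt).le
    · exact .inl (hf.apply_inj hv ha heq ▸ le_rfl)
    · rcases (show f (par b, b) ≤ f (par v, v) by omega).lt_or_eq with hlt | heq
      · exact .inr (hf.inflow_lt_inflow hb hv hlt).le
      · exact .inr (hf.apply_inj hb hv heq ▸ le_rfl)
  · exact .inl ((hf.inflow_mem_Ico v hv).2.trans_le (hf.inflow_nonneg a ha)).le

theorem inflow_add_sum_le (hf : IsLayeredLabeling G X par g M f) {x : V} (hx : x ∈ X)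
    {C D : Finset V} (hC : C ⊆ children X par x) (hD : D ⊆ children X par x)
    (hCD : Disjoint C D) (hcard : 3 ≤ C.card) :
    inflow f x + ∑ v ∈ D, f (x, v) ≤ inflow g x - (2 * M + (outerLayer X par).card) - 3 := by
  classical
  have := hf.nonneg
  have hlt : ∀ v ∈ children X par x, M + (outerLayer X par).card < f (x, v) := fun v hv ↦ by
    obtain ⟨hvX, rfl⟩ := mem_children.1 hv
    exact hf.lt_apply v (mem_innerLayer.2 ⟨hvX, hx⟩)
  have hCsum : 3 * (M + (outerLayer X par).card + 1) ≤ ∑ v ∈ C, f (x, v) := calc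
    _ ≤ C.card * (M + (outerLayer X par).card + 1) := by gcongr; exact_mod_cast hcard
    _ = C.card • (M + (outerLayer X par).card + 1) := (nsmul_eq_mul _ _).symm
    _ ≤ _ := Finset.card_nsmul_le_sum _ _ _ fun v hv ↦ hlt v (hC hv)
  have hsum : ∑ v ∈ C ∪ D, f (x, v) ≤ ∑ v ∈ children X par x, f (x, v) :=
    Finset.sum_le_sum_of_subset_of_nonneg (Finset.union_subset hC hD) fun v hv _ ↦ by
      have := hlt v hv
      omega
  rw [Finset.sum_union hCD] at hsum
  have := hf.inflow_le x hx
  omega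

end IsLayeredLabeling

section Relabeling

variable {V : Type*} {G : SimpleGraph V} {lo hi : ℤ} {f : V × V → ℤ}

/-- The labelling `f` with the labels at the star of `z` permuted by `π`: the arc `(w, z)` receives
the label of `(π w, z)`. -/
def permuteStar [DecidableEq V] (z : V) (π : Equiv.Perm V) (f : V × V → ℤ) (d : V × V) : ℤ :=
  if d.2 = z then f (π d.1, z) else if d.1 = z then f (z, π d.2) else f d

theorem isSignedLabeling_permuteStar [DecidableEq V] (hf : IsSignedLabeling G lo hi f) {z : V}
    {π : Equiv.Perm V} (hz : π z = z) (hπ : ∀ v, G.Adj (π v) z ↔ G.Adj v z) :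
    IsSignedLabeling G lo hi (permuteStar z π f) := by
  let τ (σ : Equiv.Perm V) (d : V × V) : V × V :=
    if d.2 = z then (σ d.1, z) else if d.1 = z then (z, σ d.2) else d
  have τ_comp {σ ρ : Equiv.Perm V} (hρz : ρ z = z) (hσρ : ∀ v, σ (ρ v) = v) (d : V × V) :
      τ σ (τ ρ d) = d := by
    have := hσρ d.1
    have := hσρ d.2
    grind
  have hz' : π.symm z = z := π.symm_apply_eq.2 hz.symm
  let e : Equiv.Perm (V × V) := ⟨τ π, τ π.symm, τ_comp hz π.symm_apply_apply,
    τ_comp hz' π.apply_symm_apply⟩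
  have hfe : permuteStar z π f = f ∘ e := by
    ext d
    simp only [permuteStar, Function.comp_apply, e, τ, Equiv.coe_fn_mk]
    split_ifs <;> rfl
  rw [hfe]
  refine hf.comp e (fun ⟨u, v⟩ ↦ ?_) fun ⟨u, v⟩ ↦ ?_
  · simp only [e, τ, Equiv.coe_fn_mk, Prod.swap_prod_mk]
    split_ifs with hu hv <;> simp_all
  · simp only [e, τ, Equiv.coe_fn_mk]
    split_ifs with hv hu
    · rw [← hf.adj_iff, ← hf.adj_iff, hπ, hv]
    · rw [← hf.adj_iff, ← hf.adj_iff, G.adj_comm, hπ, hu, G.adj_comm]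
    · rfl

theorem inflow_permuteStar_self [Fintype V] [DecidableEq V] (z : V) (π : Equiv.Perm V) :
    inflow (permuteStar z π f) z = inflow f z := by
  simpa only [inflow, permuteStar, if_true] using Equiv.sum_comp π fun w ↦ f (w, z)

theorem inflow_permuteStar_of_ne [Fintype V] [DecidableEq V] {z v : V} (π : Equiv.Perm V)
    (hv : v ≠ z) : inflow (permuteStar z π f) v = inflow f v + f (z, π v) - f (z, v) := by
  have h : ∀ w, permuteStar z π f (w, v) = f (w, v) +
      if w = z then f (z, π v) - f (z, v) else 0 := fun w ↦ by
    grind [permuteStar]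
  simp only [inflow, h, Finset.sum_add_distrib, Finset.sum_ite_eq', Finset.mem_univ, if_true,
    add_sub_assoc]

/-- The flow sending `c` units along the arc `d`. -/
def arcFlow [DecidableEq V] (d : V × V) (c : ℤ) : V × V → ℤ := Pi.single d c - Pi.single d.swap c

theorem inflow_arcFlow [Fintype V] [DecidableEq V] (u v : V) (c : ℤ) :
    inflow (arcFlow (u, v) c) = Pi.single v c - Pi.single u c := by
  ext w
  simp only [inflow, arcFlow, Pi.sub_apply, Finset.sum_sub_distrib, Pi.single_apply,
    Prod.swap_prod_mk, Prod.mk.injEq]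
  congr 1 <;> by_cases h : w = v <;> by_cases h' : w = u <;> simp [h, h', ite_and]

theorem isSignedLabeling_add_arcFlow [DecidableEq V] (hf : IsSignedLabeling G lo hi f)
    (d : V × V) : IsSignedLabeling G lo hi (f + arcFlow d (-2 * f d)) := by
  have hfe : f + arcFlow d (-2 * f d) = f ∘ Equiv.swap d d.swap := by
    ext d'
    have := hf.anti d
    simp only [Pi.add_apply, arcFlow, Pi.sub_apply, Pi.single_apply, Function.comp_apply,
      Equiv.swap_apply_def]
    grind
  rw [hfe]
  refine hf.comp _ (fun d' ↦ ?_) fun d' ↦ ?_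
  · simp only [Equiv.swap_apply_def]
    grind [Prod.swap_swap]
  · have := hf.anti d
    simp only [Equiv.swap_apply_def]
    grind [Prod.swap_swap]

/-- The labelling `f` with the labels of the arcs `d₁` and `d₂` interchanged. -/
def swapLabels [DecidableEq V] (d₁ d₂ : V × V) (f : V × V → ℤ) : V × V → ℤ :=
  f + (arcFlow d₁ (f d₂ - f d₁) + arcFlow d₂ (f d₁ - f d₂))

theorem swapLabels_eq_comp [DecidableEq V] (hf : IsSignedLabeling G lo hi f) {d₁ d₂ : V × V}
    (h₁ : 0 < f d₁) (h₂ : 0 < f d₂) :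
    swapLabels d₁ d₂ f =
      f ∘ (Equiv.swap d₁ d₂ * Equiv.swap d₁.swap d₂.swap : Equiv.Perm (V × V)) := by
  have := hf.anti d₁
  have := hf.anti d₂
  have hne : d₁ ≠ d₂.swap ∧ d₁ ≠ d₁.swap ∧ d₂ ≠ d₂.swap ∧ d₂ ≠ d₁.swap := by grind
  ext d
  simp only [swapLabels, Pi.add_apply, arcFlow, Pi.sub_apply, Pi.single_apply,
    Function.comp_apply, Equiv.Perm.mul_apply, Equiv.swap_apply_def]
  grind

theorem isSignedLabeling_swapLabels [DecidableEq V] (hf : IsSignedLabeling G lo hi f)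
    {d₁ d₂ : V × V} (h₁ : 0 < f d₁) (h₂ : 0 < f d₂) :
    IsSignedLabeling G lo hi (swapLabels d₁ d₂ f) := by
  have := hf.anti d₁
  have := hf.anti d₂
  have hne : d₁ ≠ d₂.swap ∧ d₁ ≠ d₁.swap ∧ d₂ ≠ d₂.swap ∧ d₂ ≠ d₁.swap := by grind
  rw [swapLabels_eq_comp hf h₁ h₂]
  refine hf.comp _ (fun d ↦ ?_) fun d ↦ ?_
  · simp only [Equiv.Perm.mul_apply, Equiv.swap_apply_def]
    grind [Prod.swap_swap]
  · simp only [Equiv.Perm.mul_apply, Equiv.swap_apply_def]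
    grind [Prod.swap_swap]

theorem swapLabels_apply_left [DecidableEq V] (hf : IsSignedLabeling G lo hi f) {d₁ d₂ : V × V}
    (h₁ : 0 < f d₁) (h₂ : 0 < f d₂) : swapLabels d₁ d₂ f d₁ = f d₂ := by
  have := hf.anti d₁
  have := hf.anti d₂
  have hne : d₁ ≠ d₂.swap ∧ d₁ ≠ d₁.swap := by grind
  simp [swapLabels_eq_comp hf h₁ h₂, Equiv.swap_apply_of_ne_of_ne, hne]

theorem swapLabels_apply_right [DecidableEq V] (hf : IsSignedLabeling G lo hi f) {d₁ d₂ : V × V}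
    (h₁ : 0 < f d₁) (h₂ : 0 < f d₂) : swapLabels d₁ d₂ f d₂ = f d₁ := by
  have := hf.anti d₁
  have := hf.anti d₂
  have hne : d₂ ≠ d₂.swap ∧ d₂ ≠ d₁.swap := by grind
  simp [swapLabels_eq_comp hf h₁ h₂, Equiv.swap_apply_of_ne_of_ne, hne]

theorem swapLabels_apply_of_ne [DecidableEq V] {d₁ d₂ d : V × V} (h₁ : d ≠ d₁) (h₂ : d ≠ d₂)
    (h₁' : d ≠ d₁.swap) (h₂' : d ≠ d₂.swap) : swapLabels d₁ d₂ f d = f d := by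
  simp [swapLabels, arcFlow, h₁, h₂, h₁', h₂']

theorem inflow_swapLabels [Fintype V] [DecidableEq V] {u₁ v₁ u₂ v₂ : V} (w : V) :
    inflow (swapLabels (u₁, v₁) (u₂, v₂) f) w = inflow f w +
      (f (u₂, v₂) - f (u₁, v₁)) * ((if w = v₁ then 1 else 0) - (if w = u₁ then 1 else 0) -
        (if w = v₂ then 1 else 0) + if w = u₂ then 1 else 0) := by
  simp only [swapLabels, inflow_add, inflow_arcFlow, Pi.sub_apply, Pi.single_apply]
  split_ifs <;> ring

end Relabeling

section StarPacking

variable {V : Type*} {G : SimpleGraph V} {X : Finset V} {Y : V → Finset V}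

/-- Pairwise disjoint stars in `G` centred at the vertices of `X`, where `Y x` is the set of leaves
of the star centred at `x ∈ X`, and no leaf lies in `X`. -/
structure IsStarPacking (G : SimpleGraph V) (X : Finset V) (Y : V → Finset V) : Prop where
  adj : ∀ x ∈ X, ∀ v ∈ Y x, G.Adj x v
  notMem : ∀ x ∈ X, ∀ v ∈ Y x, v ∉ X
  pairwiseDisjoint : (X : Set V).PairwiseDisjoint Y

theorem IsStarPacking.eq_of_mem (hY : IsStarPacking G X Y) {x x' v : V} (hx : x ∈ X)
    (hx' : x' ∈ X) (hv : v ∈ Y x) (hv' : v ∈ Y x') : x = x' :=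
  hY.pairwiseDisjoint.elim_finset hx hx' v hv hv'

theorem isStarPacking_image [DecidableEq V] {ι : Type*} {y : ι → V} {I : V → Finset ι} {T : Set ι}
    (hy : T.InjOn y) (hI : ∀ x ∈ X, ↑(I x) ⊆ T) (hdisj : (X : Set V).PairwiseDisjoint I)
    (hyX : ∀ i ∈ T, y i ∉ X) (hadj : ∀ x ∈ X, ∀ i ∈ I x, G.Adj x (y i)) :
    IsStarPacking G X fun x ↦ (I x).image y := by
  refine ⟨fun x hx ↦ Finset.forall_mem_image.2 (hadj x hx),
    fun x hx ↦ Finset.forall_mem_image.2 fun i hi ↦ hyX i (hI x hx hi), fun x hx x' hx' hne ↦ ?_⟩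
  rw [Function.onFun, Finset.disjoint_left]
  rintro _ hv hv'
  obtain ⟨i, hi, rfl⟩ := Finset.mem_image.1 hv
  obtain ⟨j, hj, hij⟩ := Finset.mem_image.1 hv'
  have hji : j = i := hy (hI x' hx' hj) (hI x hx hi) hij
  exact Finset.disjoint_left.1 (hdisj hx hx' hne) hi (hji ▸ hj)

theorem exists_adj_adj_of_edist_le_two {v : V} (hX : ∃ x ∈ X, G.edist v x ≤ 2) (hv : v ∉ X)
    (hadj : ¬ ∃ x ∈ X, G.Adj x v) : ∃ w, G.Adj w v ∧ ∃ x ∈ X, G.Adj x w := by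
  obtain ⟨x, hx, hvx⟩ := hX
  have hne : v ≠ x := fun h ↦ hv (h ▸ hx)
  have hvx' : ¬ G.Adj v x := fun h ↦ hadj ⟨x, hx, h.symm⟩
  have hcommon : G.commonNeighbors v x ≠ ∅ := fun h ↦
    hvx.not_gt (SimpleGraph.two_lt_edist_iff.2 ⟨hne, hvx', h⟩)
  obtain ⟨w, hvw, hxw⟩ := Set.nonempty_iff_ne_empty.2 hcommon
  exact ⟨w, hvw.symm, x, hx, hxw⟩

theorem IsStarPacking.exists_isParentMap [Fintype V] (hY : IsStarPacking G X Y)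
    (hX : ∀ v ∉ X, ∃ x ∈ X, G.edist v x ≤ 2) :
    ∃ par, IsParentMap G X par ∧ ∀ x ∈ X, Y x ⊆ children X par x := by
  have hex (v : V) (hv : v ∉ X) : ∃ p, G.Adj p v ∧ ((∃ x ∈ X, G.Adj x v) → p ∈ X) ∧
      (p ∉ X → ∃ x ∈ X, G.Adj x p) ∧ ∀ x ∈ X, v ∈ Y x → p = x := by
    by_cases hleaf : ∃ x ∈ X, v ∈ Y x
    · obtain ⟨x, hx, hvx⟩ := hleaf
      exact ⟨x, hY.adj x hx v hvx, fun _ ↦ hx, absurd hx,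
        fun x' hx' hvx' ↦ hY.eq_of_mem hx hx' hvx hvx'⟩
    · have no_leaf (p : V) : ∀ x ∈ X, v ∈ Y x → p = x := fun x hx hvx ↦ absurd ⟨x, hx, hvx⟩ hleaf
      by_cases hadj : ∃ x ∈ X, G.Adj x v
      · obtain ⟨x, hx, hxv⟩ := hadj
        exact ⟨x, hxv, fun _ ↦ hx, absurd hx, no_leaf x⟩
      · obtain ⟨w, hwv, hw⟩ := exists_adj_adj_of_edist_le_two (hX v hv) hv hadj
        exact ⟨w, hwv, fun h ↦ absurd h hadj, fun _ ↦ hw, no_leaf w⟩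
  choose! par adj par_mem adj_par par_eq using hex
  exact ⟨par, ⟨adj, par_mem, fun v hv hparX ↦ par_mem _ hparX (adj_par v hv hparX)⟩,
    fun x hx v hvx ↦ mem_children.2 ⟨hY.notMem x hx v hvx,
      par_eq v (hY.notMem x hx v hvx) x hx hvx⟩⟩

end StarPacking

section Singleton

variable {V : Type*} [Fintype V] {G : SimpleGraph V} {x : V}

theorem admitsAntimagicOrientation_of_two_le_degree [Fintype (G.neighborSet x)]
    (hX : ∀ v ≠ x, G.edist v x ≤ 2) (hx : 2 ≤ G.degree x) : AdmitsAntimagicOrientation G := by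
  classical
  have hY : IsStarPacking G {x} fun _ ↦ G.neighborFinset x :=
    ⟨by simp, fun _ _ v hv ↦ by
      simpa using ((G.mem_neighborFinset x v).1 hv).ne', by simp⟩
  obtain ⟨par, hpar, hchildren⟩ := hY.exists_isParentMap (by simpa using hX)
  obtain ⟨M, f, hf⟩ := hpar.exists_isLayeredLabeling (P := ⊥) .bot le_rfl bot_le (by simp)
    (fun v _ ↦ (Finset.sum_const_zero (M := ℤ)).ge) fun v _ ↦ Finset.sum_const_zero
  have hlt : ∀ v ∈ G.neighborFinset x, M + (outerLayer {x} par).card + 1 ≤ f (x, v) := by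
    intro v hv
    obtain ⟨hvX, hparv⟩ := mem_children.1 (hchildren x (by simp) hv)
    exact hparv ▸ hf.lt_apply v (by simp [hparv, Finset.notMem_singleton.1 hvX])
  have hsum : inflow f x = -∑ v ∈ G.neighborFinset x, f (x, v) := by
    rw [inflow, ← Finset.sum_neg_distrib,
      ← Finset.sum_subset (G.neighborFinset x).subset_univ fun v _ hv ↦ ?_]
    · exact Finset.sum_congr rfl fun v _ ↦ hf.isSignedLabeling.apply_swap v x
    · rwa [G.mem_neighborFinset, G.adj_comm, hf.isSignedLabeling.not_adj_iff] at hv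
  have hbound : 2 * (M + (outerLayer {x} par).card + 1) ≤ ∑ v ∈ G.neighborFinset x, f (x, v) := by
    have := hf.nonneg
    calc
      _ ≤ G.degree x * (M + (outerLayer {x} par).card + 1) := by gcongr; exact_mod_cast hx
      _ = G.degree x • (M + (outerLayer {x} par).card + 1) := (nsmul_eq_mul _ _).symm
      _ ≤ _ := Finset.card_nsmul_le_sum _ _ _ hlt
  refine hf.isSignedLabeling.admitsAntimagicOrientation_of_lt hf.isSeparatedOutside
    (fun y hy ↦ ?_) (by simp)
  rw [Finset.mem_singleton.1 hy]
  omega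

end Singleton

section CommonNeighbor

variable {V : Type*} [Fintype V] {G : SimpleGraph V} {X : Finset V} {Y : V → Finset V} {z : V}

theorem inflow_parentFlow_const [DecidableEq V] (S : Finset V) (c : V → ℤ) (r u : V) :
    inflow (parentFlow S (fun _ ↦ r) c) u =
      (if u ∈ S then c u else 0) - if u = r then ∑ v ∈ S, c v else 0 := by
  rw [inflow_parentFlow, Finset.filter_const]
  by_cases h : u = r
  · simp [h]
  · simp [h, Ne.symm h]

theorem IsSignedLabeling.admitsAntimagicOrientation_of_common_neighbor {hi B : ℤ}
    {f : V × V → ℤ} (hf : IsSignedLabeling G 0 hi f)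
    (hs : IsSeparatedOutside X B (inflow f)) (hz : z ∉ X) (hpos : ∀ x ∈ X, 0 < f (x, z))
    (hlt : ∀ x ∈ X, inflow f x + f (x, z) < B) : AdmitsAntimagicOrientation G := by
  classical
  obtain ⟨π, hπ, hmono⟩ := exists_perm_monovaryOn (fun x ↦ -(inflow f x + f (x, z)))
    (fun x ↦ f (x, z)) X
  have hπX (v : V) : π v ∈ X ↔ v ∈ X := not_iff_not.1
    ⟨fun h ↦ π.injective (hπ _ h) ▸ h, fun h ↦ (hπ v h).symm ▸ h⟩
  have hadj (v : V) : G.Adj (π v) z ↔ G.Adj v z := by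
    by_cases hv : v ∈ X
    · exact iff_of_true ((hf.adj_iff _ _).2 (hpos _ ((hπX v).2 hv)).ne')
        ((hf.adj_iff _ _).2 (hpos v hv).ne')
    · rw [hπ v hv]
  have hinflow {x : V} (hx : x ∈ X) : inflow (permuteStar z π f) x =
      inflow f x + f (x, z) - f (π x, z) := by
    rw [inflow_permuteStar_of_ne π (ne_of_mem_of_not_mem hx hz), hf.apply_swap z (π x),
      hf.apply_swap z x]
    ring
  refine (isSignedLabeling_permuteStar hf (hπ z hz) hadj).admitsAntimagicOrientation_of_lt
    (X := X) (hs.congr fun v hv ↦ ?_) (fun x hx ↦ ?_) fun x hx x' hx' h ↦ ?_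
  · by_cases hvz : v = z
    · rw [hvz, inflow_permuteStar_self]
    · rw [inflow_permuteStar_of_ne π hvz, hπ v hv, add_sub_cancel_right]
  · have := hlt x hx
    have := hpos (π x) ((hπX x).2 hx)
    rw [hinflow hx]
    omega
  · have hinj : Set.InjOn ((fun x ↦ f (x, z)) ∘ π) X := fun x hx x' hx' h ↦
      π.injective (congrArg Prod.fst (hf.bijOn.injOn (hpos _ ((hπX x).2 hx))
        (hpos _ ((hπX x').2 hx')) h))
    rw [hinflow hx, hinflow hx'] at h
    refine injOn_add_of_monovaryOn hmono hinj hx hx' ?_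
    simp only [Function.comp_apply]
    omega

theorem IsParentMap.exists_isLayeredLabeling_of_common_neighbor {par : V → V}
    (hpar : IsParentMap G X par) (hz : z ∉ X) (hz_par : par z ∈ X) (hadj : ∀ x ∈ X, G.Adj x z) :
    ∃ M g f, IsLayeredLabeling G X par g M f ∧ inflow g (par z) = 0 ∧
      ∀ x ∈ X, x ≠ par z → 0 < f (x, z) ∧ inflow g x = -f (x, z) := by
  classical
  set S := X.erase (par z)
  have hzS : z ∉ S := fun h ↦ hz (Finset.mem_of_mem_erase h)
  obtain ⟨c, hc, -⟩ := exists_bijOn_Ioc_monovaryOn (0 : V → ℤ) S 0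
  set g := -parentFlow S (fun _ ↦ z) c with hg_def
  have hg : IsSignedLabeling (parentGraph S fun _ ↦ z) 0 (0 + S.card) g :=
    (isSignedLabeling_parentFlow (fun _ _ ↦ hzS) le_rfl hc).neg
  have inflow_g (u : V) : inflow g u =
      (if u = z then ∑ v ∈ S, c v else 0) - if u ∈ S then c u else 0 := by
    rw [hg_def, inflow_neg, inflow_parentFlow_const, neg_sub]
  have g_apply (x : V) (hx : x ∈ S) : g (x, z) = c x := by
    rw [hg.apply_swap, hg_def, Pi.neg_apply, neg_neg]
    exact parentFlow_apply (fun _ _ ↦ hzS) hx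
  have hc_pos (x : V) (hx : x ∈ S) : 0 < c x := (hc.mapsTo hx).1
  have hP : ∀ v ∉ X, ¬ (parentGraph S fun _ ↦ z).Adj (par v) v := by
    simp only [parentGraph, SimpleGraph.fromRel_adj]
    grind
  have hg_inner : ∀ v ∈ innerLayer X par, 0 ≤ inflow g v := fun v hv ↦ by
    have := Finset.sum_nonneg fun v hv ↦ (hc_pos v hv).le
    grind [mem_innerLayer]
  have hg_outer : ∀ v ∈ outerLayer X par, inflow g v = 0 := by
    grind [mem_outerLayer]
  obtain ⟨M, f, hf⟩ := hpar.exists_isLayeredLabeling hg (by omega)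
    (parentGraph_le fun x hx ↦ (hadj x (Finset.mem_of_mem_erase hx)).symm) hP hg_inner hg_outer
  refine ⟨M, g, f, hf, ?_, fun x hx hne ↦ ?_⟩
  · grind
  · have hxS : x ∈ S := Finset.mem_erase.2 ⟨hne, hx⟩
    have hfx : f (x, z) = c x :=
      g_apply x hxS ▸ hf.apply_eq _ (g_apply x hxS ▸ (hc_pos x hxS).ne')
    grind

theorem IsStarPacking.admitsAntimagicOrientation_of_common_neighbor (hY : IsStarPacking G X Y)
    (hX : ∀ v ∉ X, ∃ x ∈ X, G.edist v x ≤ 2) (hcard : ∀ x ∈ X, 3 ≤ (Y x).card) (hz : z ∉ X)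
    (hzY : ∀ x ∈ X, z ∉ Y x) (hadj : ∀ x ∈ X, G.Adj x z) : AdmitsAntimagicOrientation G := by
  obtain ⟨par, hpar, hchildren⟩ := hY.exists_isParentMap hX
  obtain ⟨x₀, hx₀, -⟩ := hX z hz
  have hz_par : par z ∈ X := hpar.par_mem z hz ⟨x₀, hx₀, hadj x₀ hx₀⟩
  obtain ⟨M, g, f, hf, hg_par, hfg⟩ :=
    hpar.exists_isLayeredLabeling_of_common_neighbor hz hz_par hadj
  refine hf.isSignedLabeling.admitsAntimagicOrientation_of_common_neighbor
    hf.isSeparatedOutside hz (fun x hx ↦ ?_) fun x hx ↦ ?_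
  · by_cases hxz : x = par z
    · exact hxz ▸ hf.pos_apply (mem_innerLayer.2 ⟨hz, hz_par⟩)
    · exact (hfg x hx hxz).1
  · by_cases hxz : x = par z
    · have := hf.inflow_add_sum_le hx (hchildren x hx) (D := {z}) (by simp [hz, hxz])
        (by simpa using hzY x hx) (hcard x hx)
      rw [Finset.sum_singleton, hxz, hg_par] at this
      rw [hxz]
      omega
    · have := hf.inflow_add_sum_le hx (hchildren x hx) (D := ∅) (by simp) (by simp) (hcard x hx)
      rw [Finset.sum_empty, (hfg x hx hxz).2] at this
      omega

end CommonNeighbor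

section AdjacentPair

variable {V : Type*} [Fintype V] {G : SimpleGraph V} {x₁ x₂ : V}

theorem IsSignedLabeling.admitsAntimagicOrientation_of_adj [DecidableEq V] {hi B : ℤ}
    {f : V × V → ℤ} (hf : IsSignedLabeling G 0 hi f)
    (hs : IsSeparatedOutside {x₁, x₂} B (inflow f))
    (hlt₁ : inflow f x₁ < B) (hlt₂ : inflow f x₂ + 2 * f (x₂, x₁) < B)
    (hpos : 0 < f (x₂, x₁)) : AdmitsAntimagicOrientation G := by
  have hadj : G.Adj x₂ x₁ := (hf.adj_iff x₂ x₁).2 hpos.ne'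
  by_cases heq : inflow f x₁ = inflow f x₂
  · set f' := f + arcFlow (x₂, x₁) (-2 * f (x₂, x₁))
    have hf' : IsSignedLabeling G 0 hi f' := isSignedLabeling_add_arcFlow hf _
    have inflow_f' : inflow f' = inflow f + (Pi.single x₁ (-2 * f (x₂, x₁)) -
        Pi.single x₂ (-2 * f (x₂, x₁))) := by
      rw [← inflow_arcFlow]
      exact funext (inflow_add f _)
    have h₁ : inflow f' x₁ = inflow f x₁ - 2 * f (x₂, x₁) := by
      simp [inflow_f', hadj.ne', ← sub_eq_add_neg]
    have h₂ : inflow f' x₂ = inflow f x₂ + 2 * f (x₂, x₁) := by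
      simp [inflow_f', hadj.ne]
    refine hf'.admitsAntimagicOrientation_of_lt (hs.congr fun v hv ↦ ?_) ?_ ?_
    · obtain ⟨hv₁, hv₂⟩ : v ≠ x₁ ∧ v ≠ x₂ := by simpa using hv
      simp [inflow_f', hv₁, hv₂]
    · grind
    · simp only [Finset.coe_pair, Set.injOn_pair]
      omega
  · refine hf.admitsAntimagicOrientation_of_lt hs ?_ ?_
    · grind
    · simp [Set.injOn_pair, heq]

theorem IsStarPacking.admitsAntimagicOrientation_of_adj [DecidableEq V] {Y : V → Finset V}
    (hY : IsStarPacking G {x₁, x₂} Y)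
    (hX : ∀ v ∉ ({x₁, x₂} : Finset V), ∃ x ∈ ({x₁, x₂} : Finset V), G.edist v x ≤ 2)
    (hcard₁ : 3 ≤ (Y x₁).card) (hcard₂ : 3 ≤ (Y x₂).card) (hadj : G.Adj x₁ x₂) :
    AdmitsAntimagicOrientation G := by
  obtain ⟨par, hpar, hchildren⟩ := hY.exists_isParentMap hX
  have hroot : ∀ v ∈ ({x₁} : Finset V), x₂ ∉ ({x₁} : Finset V) := by simp [hadj.ne']
  set g := parentFlow {x₁} (fun _ ↦ x₂) fun _ ↦ 1
  have hg : IsSignedLabeling (parentGraph {x₁} fun _ ↦ x₂) 0 1 g :=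
    isSignedLabeling_parentFlow hroot le_rfl
      ⟨by simp [Set.MapsTo], by simp, fun n hn ↦ ⟨x₁, by simp, by grind⟩⟩
  have inflow_g (u : V) : inflow g u = (if u = x₁ then 1 else 0) - if u = x₂ then 1 else 0 := by
    simp [g, inflow_parentFlow_const]
  have inflow_g_of_notMem (v : V) (hv : v ∉ ({x₁, x₂} : Finset V)) : inflow g v = 0 := by
    grind
  obtain ⟨M, f, hf⟩ := hpar.exists_isLayeredLabeling hg zero_le_one
    (parentGraph_le (by simp [hadj.symm]))
    (by simp only [parentGraph, SimpleGraph.fromRel_adj]; grind)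
    (fun v hv ↦ (inflow_g_of_notMem v (mem_innerLayer.1 hv).1).ge)
    fun v hv ↦ inflow_g_of_notMem v (mem_outerLayer.1 hv).1
  have hg_apply : g (x₂, x₁) = 1 := parentFlow_apply hroot (by simp)
  have hf_apply : f (x₂, x₁) = 1 := hg_apply ▸ hf.apply_eq _ (hg_apply ▸ one_ne_zero)
  have h₁ := hf.inflow_add_sum_le (x := x₁) (by simp) (hchildren x₁ (by simp)) (D := ∅) (by simp)
    (by simp) hcard₁
  have h₂ := hf.inflow_add_sum_le (x := x₂) (by simp) (hchildren x₂ (by simp)) (D := ∅) (by simp)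
    (by simp) hcard₂
  simp only [Finset.sum_empty, inflow_g, hadj.ne, hadj.ne', if_true, if_false] at h₁ h₂
  refine hf.isSignedLabeling.admitsAntimagicOrientation_of_adj hf.isSeparatedOutside ?_ ?_ ?_
  all_goals omega

end AdjacentPair

section Chain

variable {V : Type*} [Fintype V] [DecidableEq V] {G : SimpleGraph V} {x₁ x₂ x₃ a b : V}

theorem IsSignedLabeling.exists_swap_at {lo hi u : ℤ} {f : V × V → ℤ} {x x' : V}
    (hf : IsSignedLabeling G lo hi f) (h : 0 < f (x, a)) (h' : 0 < f (x', a))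
    (hu : u = 0 ∨ u = f (x, a) - f (x', a)) :
    ∃ f', IsSignedLabeling G lo hi f' ∧
      inflow f' = inflow f + (Pi.single x u - Pi.single x' u) ∧
      ∀ w v, w ≠ a → v ≠ a → f' (w, v) = f (w, v) := by
  rcases hu with rfl | rfl
  · exact ⟨f, hf, by simp, fun _ _ _ _ ↦ rfl⟩
  · refine ⟨swapLabels (x, a) (x', a) f, isSignedLabeling_swapLabels hf h h', ?_,
      fun w v hw hv ↦ swapLabels_apply_of_ne ?_ ?_ ?_ ?_⟩
    · ext w
      simp only [inflow_swapLabels, Pi.add_apply, Pi.sub_apply, Pi.single_apply]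
      split_ifs <;> ring
    all_goals simp [hw, hv]

theorem exists_shifts_pairwise_ne {p q s₁ s₂ s₃ : ℤ} (hpq : p < 2 * q) (hqp : q < 2 * p)
    (h : p ≠ q ∨ s₁ ≠ s₃) :
    ∃ u w, (u = 0 ∨ u = p) ∧ (w = 0 ∨ w = q) ∧
      s₁ + u ≠ s₂ - u - w ∧ s₁ + u ≠ s₃ + w ∧ s₂ - u - w ≠ s₃ + w := by
  by_contra! hcon
  have h₀₀ := hcon 0 0 (.inl rfl) (.inl rfl)
  have hp₀ := hcon p 0 (.inr rfl) (.inl rfl)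
  have h₀q := hcon 0 q (.inl rfl) (.inr rfl)
  have hpq := hcon p q (.inr rfl) (.inr rfl)
  omega

theorem IsSignedLabeling.admitsAntimagicOrientation_of_chain {hi B : ℤ} {f : V × V → ℤ}
    (hf : IsSignedLabeling G 0 hi f) (hs : IsSeparatedOutside {x₁, x₂, x₃} B (inflow f))
    (h₁₂ : x₁ ≠ x₂) (h₁₃ : x₁ ≠ x₃) (h₂₃ : x₂ ≠ x₃) (h₃a : x₃ ≠ a) (hba : b ≠ a)
    (ha_pos : 0 < f (x₂, a)) (hb_pos : 0 < f (x₂, b))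
    (hpq : f (x₁, a) - f (x₂, a) < 2 * (f (x₃, b) - f (x₂, b)))
    (hqp : f (x₃, b) - f (x₂, b) < 2 * (f (x₁, a) - f (x₂, a)))
    (hne : f (x₁, a) - f (x₂, a) ≠ f (x₃, b) - f (x₂, b) ∨ inflow f x₁ ≠ inflow f x₃)
    (hlt₁ : inflow f x₁ + f (x₁, a) < B) (hlt₂ : inflow f x₂ < B)
    (hlt₃ : inflow f x₃ + f (x₃, b) < B) : AdmitsAntimagicOrientation G := by
  have h₂a : x₂ ≠ a := ((hf.adj_iff x₂ a).2 ha_pos.ne').ne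
  obtain ⟨u, w, hu, hw, hne₁₂, hne₁₃, hne₂₃⟩ :=
    exists_shifts_pairwise_ne (s₂ := inflow f x₂) hpq hqp hne
  obtain ⟨f₁, hf₁, inflow_f₁, hf₁_apply⟩ := hf.exists_swap_at (by omega) ha_pos hu
  obtain ⟨f₂, hf₂, inflow_f₂, -⟩ := hf₁.exists_swap_at (x := x₃) (x' := x₂) (a := b) (u := w)
    (by rw [hf₁_apply _ _ h₃a hba]; omega) (by rw [hf₁_apply _ _ h₂a hba]; exact hb_pos)
    (by rwa [hf₁_apply _ _ h₃a hba, hf₁_apply _ _ h₂a hba])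
  have h₁ : inflow f₂ x₁ = inflow f x₁ + u := by simp [inflow_f₂, inflow_f₁, h₁₂, h₁₃]
  have h₂ : inflow f₂ x₂ = inflow f x₂ - u - w := by
    simp [inflow_f₂, inflow_f₁, h₁₂.symm, h₂₃, sub_eq_add_neg]
  have h₃ : inflow f₂ x₃ = inflow f x₃ + w := by
    simp [inflow_f₂, inflow_f₁, h₁₃.symm, h₂₃.symm]
  refine hf₂.admitsAntimagicOrientation_of_lt (hs.congr fun v hv ↦ ?_) ?_ ?_
  · simp only [Finset.mem_insert, Finset.mem_singleton, not_or] at hv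
    simp [inflow_f₂, inflow_f₁, hv]
  · simp only [Finset.mem_insert, Finset.mem_singleton, forall_eq_or_imp, forall_eq]
    omega
  · simp only [Finset.coe_insert, Finset.coe_singleton]
    rw [Set.InjOn]
    grind

theorem IsSignedLabeling.admitsAntimagicOrientation_of_chain_of_swapLabels {hi B : ℤ}
    {f : V × V → ℤ} (hf : IsSignedLabeling G 0 hi f)
    (hs : IsSeparatedOutside {x₁, x₂, x₃} B (inflow (swapLabels (x₁, a) (x₃, b) f)))
    (h₁₂ : x₁ ≠ x₂) (h₁₃ : x₁ ≠ x₃) (h₂₃ : x₂ ≠ x₃) (ha : a ∉ ({x₁, x₂, x₃} : Finset V))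
    (hb : b ∉ ({x₁, x₂, x₃} : Finset V)) (hba : b ≠ a) (hfa : f (x₂, a) = 2) (hfb : f (x₂, b) = 1)
    (hfa_lt : 2 < f (x₁, a)) (hconsec : f (x₃, b) = f (x₁, a) + 1)
    (heq : inflow f x₁ = inflow f x₃) (hlt₂ : inflow f x₂ < B)
    (hlt₃ : inflow f x₃ + f (x₃, b) < B) : AdmitsAntimagicOrientation G := by
  simp only [Finset.mem_insert, Finset.mem_singleton, not_or] at ha hb
  have h₁_pos : 0 < f (x₁, a) := by omega
  have h₃_pos : 0 < f (x₃, b) := by omega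
  set f' := swapLabels (x₁, a) (x₃, b) f
  have hf' : IsSignedLabeling G 0 hi f' := isSignedLabeling_swapLabels hf h₁_pos h₃_pos
  have hf'₁ : f' (x₁, a) = f (x₁, a) + 1 := hconsec ▸ swapLabels_apply_left hf h₁_pos h₃_pos
  have hf'₃ : f' (x₃, b) = f (x₁, a) := swapLabels_apply_right hf h₁_pos h₃_pos
  have hf'a : f' (x₂, a) = 2 :=
    hfa ▸ swapLabels_apply_of_ne (by grind) (by grind) (by grind) (by grind)
  have hf'b : f' (x₂, b) = 1 :=
    hfb ▸ swapLabels_apply_of_ne (by grind) (by grind) (by grind) (by grind)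
  have h₁ : inflow f' x₁ = inflow f x₁ - 1 := by rw [inflow_swapLabels]; grind
  have h₂ : inflow f' x₂ = inflow f x₂ := by rw [inflow_swapLabels]; grind
  have h₃ : inflow f' x₃ = inflow f x₃ + 1 := by rw [inflow_swapLabels]; grind
  exact hf'.admitsAntimagicOrientation_of_chain hs h₁₂ h₁₃ h₂₃ (Ne.symm ha.2.2) hba (by omega)
    (by omega) (by omega) (by omega) (by omega) (by omega) (by omega) (by omega)

namespace IsLayeredLabeling

variable {X : Finset V} {par : V → V} {g f : V × V → ℤ} {M : ℤ}

/- No sum outside `X` lies between those of `a` and `b`. Interchanging two labels `f (z, a)` and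
`f (z, b)` that differ by one moves these sums towards each other by one each, which is harmless
unless they differ by two; in that case a second interchange at the parents swaps the two sums. -/
theorem isSeparatedOutside_swapLabels (hf : IsLayeredLabeling G X par g M f)
    (ha : a ∈ innerLayer X par) (hb : b ∈ innerLayer X par)
    (hconsec : f (par b, b) = f (par a, a) + 1) {z : V} (hz : f (z, b) = f (z, a) + 1)
    (hne : inflow f b - inflow f a ≠ 2) :
    IsSeparatedOutside X (-(2 * M + (outerLayer X par).card))
      (inflow (swapLabels (z, a) (z, b) f)) := by
  have hab : a ≠ b := by grind
  refine hf.isSeparatedOutside.of_add_one_sub_one (mem_innerLayer.1 ha).1 (mem_innerLayer.1 hb).1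
    (hf.inflow_lt_inflow ha hb (by omega)) hne (fun v hv ↦ hf.inflow_le_or_le ha hb hconsec hv)
    ?_ ?_ fun v _ hva hvb ↦ ?_
  · simp [inflow_swapLabels, hz, hab]
  · simp [inflow_swapLabels, hz, hab.symm, sub_eq_add_neg]
  · simp [inflow_swapLabels, hva, hvb]

theorem isSeparatedOutside_swapLabels_swapLabels (hf : IsLayeredLabeling G X par g M f)
    (ha : a ∈ innerLayer X par) (hb : b ∈ innerLayer X par)
    (hconsec : f (par b, b) = f (par a, a) + 1) {z : V} (hzX : z ∈ X) (hza : z ≠ par a)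
    (hzb : z ≠ par b) (hz : f (z, b) = f (z, a) + 1) (heq : inflow f b - inflow f a = 2) :
    IsSeparatedOutside X (-(2 * M + (outerLayer X par).card))
      (inflow (swapLabels (par a, a) (par b, b) (swapLabels (z, a) (z, b) f))) := by
  obtain ⟨haX, haX'⟩ := mem_innerLayer.1 ha
  obtain ⟨hbX, hbX'⟩ := mem_innerLayer.1 hb
  have hab : a ≠ b := by grind
  have apply_a : swapLabels (z, a) (z, b) f (par a, a) = f (par a, a) :=
    swapLabels_apply_of_ne (by grind) (by grind) (by grind) (by grind)
  have apply_b : swapLabels (z, a) (z, b) f (par b, b) = f (par b, b) :=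
    swapLabels_apply_of_ne (by grind) (by grind) (by grind) (by grind)
  refine hf.isSeparatedOutside.of_swap haX hbX fun v hv ↦ ?_
  have hva : v ≠ par a := ne_of_mem_of_not_mem haX' hv |>.symm
  have hvb : v ≠ par b := ne_of_mem_of_not_mem hbX' hv |>.symm
  rw [inflow_swapLabels, inflow_swapLabels, apply_a, apply_b, Equiv.swap_apply_def]
  grind

theorem admitsAntimagicOrientation_of_chain_of_consecutive
    (hf : IsLayeredLabeling G {x₁, x₂, x₃} par g M f)
    (h₁₂ : x₁ ≠ x₂) (h₁₃ : x₁ ≠ x₃) (h₂₃ : x₂ ≠ x₃)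
    (ha : a ∈ children {x₁, x₂, x₃} par x₁) (hb : b ∈ children {x₁, x₂, x₃} par x₃)
    (hfa : f (x₂, a) = 1) (hfb : f (x₂, b) = 2) (hfa_lt : 4 < f (x₁, a))
    (hconsec : f (x₃, b) = f (x₁, a) + 1) (heq : inflow f x₁ = inflow f x₃)
    (hlt₁ : inflow f x₁ + f (x₁, a) < -(2 * M + (outerLayer {x₁, x₂, x₃} par).card))
    (hlt₂ : inflow f x₂ < -(2 * M + (outerLayer {x₁, x₂, x₃} par).card))
    (hlt₃ : inflow f x₃ + f (x₃, b) < -(2 * M + (outerLayer {x₁, x₂, x₃} par).card)) :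
    AdmitsAntimagicOrientation G := by
  set X : Finset V := {x₁, x₂, x₃}
  have ha_inner : a ∈ innerLayer X par := by grind [mem_children, mem_innerLayer]
  have hb_inner : b ∈ innerLayer X par := by grind [mem_children, mem_innerLayer]
  obtain ⟨haX, rfl⟩ := mem_children.1 ha
  obtain ⟨hbX, rfl⟩ := mem_children.1 hb
  have hab : a ≠ b := by grind
  have hz : f (x₂, b) = f (x₂, a) + 1 := by omega
  have ha_pos : 0 < f (x₂, a) := by omega
  have hb_pos : 0 < f (x₂, b) := by omega
  set f₁ := swapLabels (x₂, a) (x₂, b) f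
  have hf₁ : IsSignedLabeling G 0 _ f₁ :=
    isSignedLabeling_swapLabels hf.isSignedLabeling ha_pos hb_pos
  have f₁_x₂a : f₁ (x₂, a) = 2 := hfb ▸ swapLabels_apply_left hf.isSignedLabeling ha_pos hb_pos
  have f₁_x₂b : f₁ (x₂, b) = 1 := hfa ▸ swapLabels_apply_right hf.isSignedLabeling ha_pos hb_pos
  have f₁_x₁a : f₁ (par a, a) = f (par a, a) :=
    swapLabels_apply_of_ne (by grind) (by grind) (by grind) (by grind)
  have f₁_x₃b : f₁ (par b, b) = f (par b, b) :=
    swapLabels_apply_of_ne (by grind) (by grind) (by grind) (by grind)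
  have inflow_f₁ (x : V) (hx : x ∈ X) : inflow f₁ x = inflow f x := by
    rw [inflow_swapLabels]
    grind
  by_cases hgap : inflow f b - inflow f a = 2
  · exact hf₁.admitsAntimagicOrientation_of_chain_of_swapLabels
      (hf.isSeparatedOutside_swapLabels_swapLabels ha_inner hb_inner hconsec (by grind) h₁₂.symm
        h₂₃ hz hgap) h₁₂ h₁₃ h₂₃ haX hbX hab.symm f₁_x₂a f₁_x₂b (by omega) (by omega) (by grind)
      (by grind) (by grind)
  · have hs : IsSeparatedOutside X _ (inflow f₁) := hf.isSeparatedOutside_swapLabels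
      ha_inner hb_inner hconsec hz hgap
    refine hf₁.admitsAntimagicOrientation_of_chain hs h₁₂ h₁₃ h₂₃ (a := a) (b := b) ?_ hab.symm
      ?_ ?_ ?_ ?_ ?_ ?_ ?_ ?_
    all_goals grind

theorem admitsAntimagicOrientation_of_chain
    (hf : IsLayeredLabeling G {x₁, x₂, x₃} par g M f)
    (h₁₂ : x₁ ≠ x₂) (h₁₃ : x₁ ≠ x₃) (h₂₃ : x₂ ≠ x₃)
    (ha : a ∈ children {x₁, x₂, x₃} par x₁) (hb : b ∈ children {x₁, x₂, x₃} par x₃)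
    (hfa : f (x₂, a) = 1) (hfb : f (x₂, b) = 2) (hM : (innerLayer {x₁, x₂, x₃} par).card +
      (outerLayer {x₁, x₂, x₃} par).card + 2 ≤ M)
    (hlt₁ : inflow f x₁ + f (x₁, a) < -(2 * M + (outerLayer {x₁, x₂, x₃} par).card))
    (hlt₂ : inflow f x₂ < -(2 * M + (outerLayer {x₁, x₂, x₃} par).card))
    (hlt₃ : inflow f x₃ + f (x₃, b) < -(2 * M + (outerLayer {x₁, x₂, x₃} par).card)) :
    AdmitsAntimagicOrientation G := by
  set X : Finset V := {x₁, x₂, x₃}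
  have ha_inner : a ∈ innerLayer X par := by grind [mem_children, mem_innerLayer]
  have hb_inner : b ∈ innerLayer X par := by grind [mem_children, mem_innerLayer]
  obtain ⟨haX, rfl⟩ := mem_children.1 ha
  obtain ⟨hbX, rfl⟩ := mem_children.1 hb
  have hab : a ≠ b := by grind
  have hα := hf.lt_apply a ha_inner
  have hβ := hf.lt_apply b hb_inner
  have hα' := (hf.isSignedLabeling.bijOn.mapsTo (hf.pos_apply ha_inner)).2
  have hβ' := (hf.isSignedLabeling.bijOn.mapsTo (hf.pos_apply hb_inner)).2
  by_cases hne : f (par a, a) - 1 ≠ f (par b, b) - 2 ∨ inflow f (par a) ≠ inflow f (par b)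
  · refine hf.isSignedLabeling.admitsAntimagicOrientation_of_chain (a := a) (b := b)
      hf.isSeparatedOutside h₁₂ h₁₃ h₂₃ ?_ hab.symm ?_ ?_ ?_ ?_ ?_ hlt₁ hlt₂ hlt₃ <;> grind
  · exact hf.admitsAntimagicOrientation_of_chain_of_consecutive h₁₂ h₁₃ h₂₃ ha hb hfa hfb
      (by have : 0 < (innerLayer X par).card := Finset.card_pos.2 ⟨a, ha_inner⟩
          omega) (by omega) (by omega) hlt₁ hlt₂ hlt₃

end IsLayeredLabeling

end Chain

section ChainPacking

variable {V : Type*} [Fintype V] {G : SimpleGraph V} {X : Finset V} {x a b : V}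

theorem IsParentMap.exists_isLayeredLabeling_of_adj_of_adj {par : V → V}
    (hpar : IsParentMap G X par) (hx : x ∈ X) (ha : a ∉ X) (hb : b ∉ X) (hab : a ≠ b)
    (ha_par : par a ≠ x) (hb_par : par b ≠ x) (hxa : G.Adj x a) (hxb : G.Adj x b) :
    ∃ M g f, IsLayeredLabeling G X par g M f ∧ f (x, a) = 1 ∧ f (x, b) = 2 ∧
      inflow g x = -3 ∧ ∀ x' ∈ X, x' ≠ x → inflow g x' = 0 := by
  classical
  set c : V → ℤ := fun v ↦ if v = a then 1 else 2
  have hroot : ∀ v ∈ ({a, b} : Finset V), x ∉ ({a, b} : Finset V) := by grind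
  set g := parentFlow {a, b} (fun _ ↦ x) c
  have hg : IsSignedLabeling (parentGraph {a, b} fun _ ↦ x) 0 2 g := by
    refine isSignedLabeling_parentFlow hroot le_rfl ⟨?_, ?_, fun n hn ↦ ?_⟩
    · grind [Set.MapsTo]
    · grind [Set.InjOn]
    · obtain rfl | rfl : n = 1 ∨ n = 2 := by grind
      · exact ⟨a, by simp, by simp [c]⟩
      · exact ⟨b, by simp, by simp [c, hab.symm]⟩
  have inflow_g (u : V) : inflow g u =
      (if u ∈ ({a, b} : Finset V) then c u else 0) - if u = x then 3 else 0 := by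
    rw [inflow_parentFlow_const, Finset.sum_pair hab]
    grind
  have hP : ∀ v ∉ X, ¬ (parentGraph {a, b} fun _ ↦ x).Adj (par v) v := by
    simp only [parentGraph, SimpleGraph.fromRel_adj]
    grind
  have hpar_a : par a ∈ X := hpar.par_mem a ha ⟨x, hx, hxa⟩
  have hpar_b : par b ∈ X := hpar.par_mem b hb ⟨x, hx, hxb⟩
  obtain ⟨M, f, hf⟩ := hpar.exists_isLayeredLabeling hg zero_le_two
    (parentGraph_le (by simp [hxa, hxb])) hP (by grind [mem_innerLayer])
    (by grind [mem_outerLayer])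
  have f_apply (v : V) (hv : v ∈ ({a, b} : Finset V)) : f (x, v) = c v := by
    have hgv : g (x, v) = c v := parentFlow_apply hroot hv
    rw [← hgv]
    exact hf.apply_eq _ (by grind)
  exact ⟨M, g, f, hf, by grind, by grind, by grind, by grind⟩

theorem IsStarPacking.admitsAntimagicOrientation_of_chain [DecidableEq V] {x₁ x₂ x₃ : V}
    {Y : V → Finset V} (hY : IsStarPacking G {x₁, x₂, x₃} Y)
    (hX : ∀ v ∉ ({x₁, x₂, x₃} : Finset V), ∃ x ∈ ({x₁, x₂, x₃} : Finset V), G.edist v x ≤ 2)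
    (h₁₂ : x₁ ≠ x₂) (h₁₃ : x₁ ≠ x₃) (h₂₃ : x₂ ≠ x₃) (hcard₁ : 4 ≤ (Y x₁).card)
    (hcard₂ : 3 ≤ (Y x₂).card) (hcard₃ : 4 ≤ (Y x₃).card) (ha : a ∈ Y x₁) (hb : b ∈ Y x₃)
    (hxa : G.Adj x₂ a) (hxb : G.Adj x₂ b) [Fintype G.edgeSet]
    (hedges : 2 * (Fintype.card V : ℤ) - 4 ≤ G.edgeFinset.card) :
    AdmitsAntimagicOrientation G := by
  obtain ⟨par, hpar, hchildren⟩ := hY.exists_isParentMap hX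
  have ha_child := hchildren x₁ (by simp) ha
  have hb_child := hchildren x₃ (by simp) hb
  obtain ⟨haX, ha_par⟩ := mem_children.1 ha_child
  obtain ⟨hbX, hb_par⟩ := mem_children.1 hb_child
  have hab : a ≠ b := by grind
  obtain ⟨M, g, f, hf, hfa, hfb, hg₂, hg⟩ := hpar.exists_isLayeredLabeling_of_adj_of_adj
    (x := x₂) (by simp) haX hbX hab (by grind) (by grind) hxa hxb
  have h₁ := hf.inflow_add_sum_le (x := x₁) (by simp)
    (((Y x₁).erase_subset a).trans (hchildren x₁ (by simp)))
    (Finset.singleton_subset_iff.2 ha_child) (by simp) (by grind)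
  have h₂ := hf.inflow_add_sum_le (x := x₂) (by simp) (hchildren x₂ (by simp)) (D := ∅) (by simp)
    (by simp) hcard₂
  have h₃ := hf.inflow_add_sum_le (x := x₃) (by simp)
    (((Y x₃).erase_subset b).trans (hchildren x₃ (by simp)))
    (Finset.singleton_subset_iff.2 hb_child) (by simp) (by grind)
  rw [Finset.sum_singleton, hg _ (by simp) (by grind)] at h₁ h₃
  rw [Finset.sum_empty, hg₂] at h₂
  have hM := hf.isSignedLabeling.card_edgeFinset (by have := hf.nonneg; omega)
  have := card_innerLayer_add_card_outerLayer {x₁, x₂, x₃} par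
  have : ({x₁, x₂, x₃} : Finset V).card = 3 :=
    Finset.card_eq_three.2 ⟨_, _, _, h₁₂, h₁₃, h₂₃, rfl⟩
  exact hf.admitsAntimagicOrientation_of_chain h₁₂ h₁₃ h₂₃ ha_child hb_child hfa hfb (by omega)
    (by omega) (by omega) (by omega)

end ChainPacking

section IndexedNeighbors

variable {V : Type*} [Fintype V] [DecidableEq V] {G : SimpleGraph V} {x₁ x₂ x₃ : V} {y : ℕ → V}

theorem admitsAntimagicOrientation_of_pair (h₁₂ : x₁ ≠ x₂)
    (hX : ∀ v ∉ ({x₁, x₂} : Finset V), ∃ x ∈ ({x₁, x₂} : Finset V), G.edist v x ≤ 2)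
    (hy : Set.InjOn y (Set.Icc 1 7)) (hyX : ∀ i ∈ Set.Icc 1 7, y i ∉ ({x₁, x₂} : Finset V))
    (h₁ : IsCompleteTo G x₁ {y 1, y 2, y 3, x₂} ∨ IsCompleteTo G x₁ {y 1, y 2, y 3, y 4})
    (h₂ : IsCompleteTo G x₂ {y 4, y 5, y 6, y 7}) : AdmitsAntimagicOrientation G := by
  obtain ⟨I, hI₁, hI₂⟩ : ∃ I : V → Finset ℕ, I x₁ = {1, 2, 3} ∧ I x₂ = {5, 6, 7} :=
    ⟨fun x ↦ if x = x₁ then {1, 2, 3} else {5, 6, 7}, by simp [h₁₂.symm]⟩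
  have hI : ∀ x ∈ ({x₁, x₂} : Finset V), ↑(I x) ⊆ Set.Icc 1 7 := by
    simp [hI₁, hI₂, Set.insert_subset_iff]
  have hcard : ∀ x ∈ ({x₁, x₂} : Finset V), 3 ≤ ((I x).image y).card := by
    intro x hx
    rw [Finset.card_image_of_injOn (hy.mono (hI x hx))]
    revert x
    simp [hI₁, hI₂]
  have hY := isStarPacking_image (G := G) hy hI
    (by simp [Set.pairwiseDisjoint_insert, hI₁, hI₂]) hyX
    (by rcases h₁ with h₁ | h₁ <;> simp_all [IsCompleteTo])
  rcases h₁ with h₁ | h₁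
  · exact hY.admitsAntimagicOrientation_of_adj hX (hcard x₁ (by simp)) (hcard x₂ (by simp))
      (h₁ x₂ (by simp))
  · refine hY.admitsAntimagicOrientation_of_common_neighbor (z := y 4) hX hcard
      (hyX 4 (by simp)) (fun x hx ↦ ?_) (by simp_all [IsCompleteTo])
    rw [← Finset.mem_coe, Finset.coe_image, hy.mem_image_iff (hI x hx) (by simp)]
    revert x
    simp [hI₁, hI₂]

theorem admitsAntimagicOrientation_of_triple_of_common_neighbor
    (h₁₂ : x₁ ≠ x₂) (h₁₃ : x₁ ≠ x₃) (h₂₃ : x₂ ≠ x₃)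
    (hX : ∀ v ∉ ({x₁, x₂, x₃} : Finset V), ∃ x ∈ ({x₁, x₂, x₃} : Finset V), G.edist v x ≤ 2)
    (hy : Set.InjOn y (Set.Icc 1 11))
    (hyX : ∀ i ∈ Set.Icc 1 11, y i ∉ ({x₁, x₂, x₃} : Finset V))
    (h₁ : IsCompleteTo G x₁ {y 1, y 2, y 3, y 4})
    (h₂ : IsCompleteTo G x₂ {y 4, y 5, y 6, y 7, y 8})
    (h₃ : IsCompleteTo G x₃ {y 4, y 9, y 10, y 11}) : AdmitsAntimagicOrientation G := by
  obtain ⟨I, hI₁, hI₂, hI₃⟩ :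
      ∃ I : V → Finset ℕ, I x₁ = {1, 2, 3} ∧ I x₂ = {5, 6, 7} ∧ I x₃ = {9, 10, 11} :=
    ⟨fun x ↦ if x = x₁ then {1, 2, 3} else if x = x₂ then {5, 6, 7} else {9, 10, 11},
      by simp [h₁₂.symm, h₁₃.symm, h₂₃.symm]⟩
  have hI : ∀ x ∈ ({x₁, x₂, x₃} : Finset V), ↑(I x) ⊆ Set.Icc 1 11 := by
    simp [hI₁, hI₂, hI₃, Set.insert_subset_iff]
  have hcard : ∀ x ∈ ({x₁, x₂, x₃} : Finset V), 3 ≤ ((I x).image y).card := by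
    intro x hx
    rw [Finset.card_image_of_injOn (hy.mono (hI x hx))]
    revert x
    simp [hI₁, hI₂, hI₃]
  have hY := isStarPacking_image (G := G) hy hI
    (by simp [Set.pairwiseDisjoint_insert, hI₁, hI₂, hI₃]) hyX
    (by simp_all [IsCompleteTo])
  refine hY.admitsAntimagicOrientation_of_common_neighbor (z := y 4) hX hcard
    (hyX 4 (by simp)) (fun x hx ↦ ?_) (by simp_all [IsCompleteTo])
  rw [← Finset.mem_coe, Finset.coe_image, hy.mem_image_iff (hI x hx) (by simp)]
  revert x
  simp [hI₁, hI₂, hI₃]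

theorem admitsAntimagicOrientation_of_triple_of_chain
    (h₁₂ : x₁ ≠ x₂) (h₁₃ : x₁ ≠ x₃) (h₂₃ : x₂ ≠ x₃)
    (hX : ∀ v ∉ ({x₁, x₂, x₃} : Finset V), ∃ x ∈ ({x₁, x₂, x₃} : Finset V), G.edist v x ≤ 2)
    (hy : Set.InjOn y (Set.Icc 1 11))
    (hyX : ∀ i ∈ Set.Icc 1 11, y i ∉ ({x₁, x₂, x₃} : Finset V))
    (h₁ : IsCompleteTo G x₁ {y 1, y 2, y 3, y 4})
    (h₂ : IsCompleteTo G x₂ {y 4, y 5, y 6, y 7, y 8})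
    (h₃ : IsCompleteTo G x₃ {y 8, y 9, y 10, y 11}) [Fintype G.edgeSet]
    (hedges : 2 * (Fintype.card V : ℤ) - 4 ≤ G.edgeFinset.card) :
    AdmitsAntimagicOrientation G := by
  obtain ⟨I, hI₁, hI₂, hI₃⟩ :
      ∃ I : V → Finset ℕ, I x₁ = {1, 2, 3, 4} ∧ I x₂ = {5, 6, 7} ∧ I x₃ = {8, 9, 10, 11} :=
    ⟨fun x ↦ if x = x₁ then {1, 2, 3, 4} else if x = x₂ then {5, 6, 7} else {8, 9, 10, 11},
      by simp [h₁₂.symm, h₁₃.symm, h₂₃.symm]⟩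
  have hI : ∀ x ∈ ({x₁, x₂, x₃} : Finset V), ↑(I x) ⊆ Set.Icc 1 11 := by
    simp [hI₁, hI₂, hI₃, Set.insert_subset_iff]
  have hcard (x : V) (hx : x ∈ ({x₁, x₂, x₃} : Finset V)) :
      ((I x).image y).card = (I x).card :=
    Finset.card_image_of_injOn (hy.mono (hI x hx))
  have hY := isStarPacking_image (G := G) hy hI
    (by simp [Set.pairwiseDisjoint_insert, hI₁, hI₂, hI₃]) hyX
    (by simp_all [IsCompleteTo])
  exact hY.admitsAntimagicOrientation_of_chain hX h₁₂ h₁₃ h₂₃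
    ((hcard x₁ (by simp)).trans (by simp [hI₁])).ge
    ((hcard x₂ (by simp)).trans (by simp [hI₂])).ge
    ((hcard x₃ (by simp)).trans (by simp [hI₃])).ge
    (Finset.mem_image_of_mem y (a := 4) (by simp [hI₁]))
    (Finset.mem_image_of_mem y (a := 8) (by simp [hI₃]))
    (h₂ _ (by simp)) (h₂ _ (by simp)) hedges

end IndexedNeighbors

theorem theorem1p6_general {V : Type*} [Fintype V] [DecidableEq V]
    (G : SimpleGraph V) [DecidableRel G.Adj] (X : Finset V)
    (hX : ∀ v ∉ X, ∃ x ∈ X, G.edist v x ≤ 2)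
    (h :
      (∃ x₁ : V, X = {x₁} ∧ 2 ≤ G.degree x₁) ∨
      (∃ x₁ x₂ : V, x₁ ≠ x₂ ∧ X = {x₁, x₂} ∧
        ∃ y : ℕ → V, Set.InjOn y (Set.Icc 1 7) ∧ (∀ i ∈ Set.Icc 1 7, y i ∉ X) ∧
          (IsCompleteTo G x₁ {y 1, y 2, y 3, x₂} ∨ IsCompleteTo G x₁ {y 1, y 2, y 3, y 4}) ∧
          IsCompleteTo G x₂ {y 4, y 5, y 6, y 7}) ∨
      (∃ x₁ x₂ x₃ : V, x₁ ≠ x₂ ∧ x₁ ≠ x₃ ∧ x₂ ≠ x₃ ∧ X = {x₁, x₂, x₃} ∧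
        ∃ y : ℕ → V, Set.InjOn y (Set.Icc 1 11) ∧ (∀ i ∈ Set.Icc 1 11, y i ∉ X) ∧
          IsCompleteTo G x₁ {y 1, y 2, y 3, y 4} ∧
          IsCompleteTo G x₂ {y 4, y 5, y 6, y 7, y 8} ∧
          (IsCompleteTo G x₃ {y 4, y 9, y 10, y 11} ∨
            2 * (Fintype.card V : ℤ) - 4 ≤ (G.edgeFinset.card : ℤ) ∧
              IsCompleteTo G x₃ {y 8, y 9, y 10, y 11}))) :
    AdmitsAntimagicOrientation G := by
  rcases h with ⟨x₁, rfl, hdeg⟩ | ⟨x₁, x₂, h₁₂, rfl, y, hy, hyX, h₁, h₂⟩ |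
    ⟨x₁, x₂, x₃, h₁₂, h₁₃, h₂₃, rfl, y, hy, hyX, h₁, h₂, h₃⟩
  · exact admitsAntimagicOrientation_of_two_le_degree (by simpa using hX) hdeg
  · exact admitsAntimagicOrientation_of_pair h₁₂ hX hy hyX h₁ h₂
  · rcases h₃ with h₃ | ⟨hedges, h₃⟩
    · exact admitsAntimagicOrientation_of_triple_of_common_neighbor h₁₂ h₁₃ h₂₃ hX hy hyX h₁ h₂ h₃
    · exact admitsAntimagicOrientation_of_triple_of_chain h₁₂ h₁₃ h₂₃ hX hy hyX h₁ h₂ h₃ hedges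

theorem theorem1p6 {V : Type*} [Fintype V] [DecidableEq V]
    (G : SimpleGraph V) [DecidableRel G.Adj] (hG : G.Connected)
    (X : Finset V)
    (hX : ∀ v : V, v ∉ X → ∃ x ∈ X, G.dist v x ≤ 2)
    (h :
      (∃ x₁ : V, X = {x₁} ∧ 2 ≤ G.degree x₁) ∨
      (∃ x₁ x₂ : V, x₁ ≠ x₂ ∧ X = {x₁, x₂} ∧
        (2 * (Fintype.card V : ℤ) - 5 ≤ (G.edgeFinset.card : ℤ)) ∧
        ∃ y : ℕ → V, Set.InjOn y (Set.Icc 1 7) ∧ (∀ i ∈ Set.Icc 1 7, y i ∉ X) ∧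
          (IsCompleteTo G x₁ {y 1, y 2, y 3, x₂} ∨ IsCompleteTo G x₁ {y 1, y 2, y 3, y 4}) ∧
          IsCompleteTo G x₂ {y 4, y 5, y 6, y 7}) ∨
      (∃ x₁ x₂ x₃ : V, x₁ ≠ x₂ ∧ x₁ ≠ x₃ ∧ x₂ ≠ x₃ ∧ X = {x₁, x₂, x₃} ∧
        (2 * (Fintype.card V : ℤ) - 4 ≤ (G.edgeFinset.card : ℤ)) ∧
        ∃ y : ℕ → V, Set.InjOn y (Set.Icc 1 11) ∧ (∀ i ∈ Set.Icc 1 11, y i ∉ X) ∧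
          IsCompleteTo G x₁ {y 1, y 2, y 3, y 4} ∧
          IsCompleteTo G x₂ {y 4, y 5, y 6, y 7, y 8} ∧
          (IsCompleteTo G x₃ {y 4, y 9, y 10, y 11} ∨
            IsCompleteTo G x₃ {y 8, y 9, y 10, y 11}))) :
    AdmitsAntimagicOrientation G := by
  refine theorem1p6_general G X (fun v hv ↦ ?_) ?_
  · obtain ⟨x, hx, hvx⟩ := hX v hv
    exact ⟨x, hx, by rw [← (hG v x).coe_dist_eq_edist]; exact_mod_cast hvx⟩
  · rcases h with h | ⟨x₁, x₂, h₁₂, rfl, -, h⟩ |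
      ⟨x₁, x₂, x₃, h₁₂, h₁₃, h₂₃, rfl, hedges, y, hy, hyX, h₁, h₂, h₃⟩
    · exact .inl h
    · exact .inr (.inl ⟨x₁, x₂, h₁₂, rfl, h⟩)
    · exact .inr (.inr ⟨x₁, x₂, x₃, h₁₂, h₁₃, h₂₃, rfl, y, hy, hyX, h₁, h₂,
        h₃.imp_right (.intro hedges)⟩)
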